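/- Let $N\ge 2$ and $1<p<N$, put $p^*=\frac{Np}{N-p}$ and $v_a(x)=a|x|^{-\frac{N-p}{p}}$ for $a\in\mathbb R$. For a measurable $f$ on $\mathbb R^N$ let $f^*(t)=\inf\{\lambda>0:\ |\{|f|>\lambda\}|\le t\}$ be its decreasing rearrangement, and let $$\|f\|_{L^{p^*,p}}=\Big(\int_0^\infty \big(t^{1/p^*}f^*(t)\big)^p\,\frac{dt}{t}\Big)^{1/p},\qquad \|f\|_{L^{p^*,\infty}}=\sup_{t>0}t^{1/p^*}f^*(t),\qquad d_p(u)=\inf_{a\in\mathbb R}\frac{\|u-v_a\|_{L^{p^*,\infty}}}{\|u\|_{L^{p^*,p}}},$$ with the convention $d_p(0)=0$. Then there is a constant $C=C(N,p)>0$ such that the following holds. Let $u:\mathbb R^N\to\mathbb R$ be weakly differentiable (that is, $u$ is locally integrable and has a locally integrable weak gradient $\nabla u$), decaying to zero at infinity in the sense that $|\{|u|>t\}|<\infty$ for every $t>0$, and such that $|\nabla u|\in L^p(\mathbb R^N)$. Then $\int_{\mathbb R^N}\frac{|u|^p}{|x|^p}\,dx$, $\|u\|_{L^{p^*,p}}$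 and $d_p(u)$ are finite, and $$\int_{\mathbb R^N}|\nabla u|^p\,dx-\Big(\frac{N-p}{p}\Big)^p\int_{\mathbb R^N}\frac{|u|^p}{|x|^p}\,dx\ \ge\ C\,d_p(u)^{\max\{4,2p\}}\int_{\mathbb R^N}\frac{|u|^p}{|x|^p}\,dx .$$ -/

import Mathlib

open MeasureTheory Set
open scoped ENNReal ContDiff

noncomputable section

namespace HardyStability

/-- The locally integrable vector field `G` is the weak gradient of the locally integrable
function `u` on `ℝ^N`: `∫ u ∂_e φ = - ∫ φ ⟨G, e⟩` for all test functions `φ` and directions `e`. -/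
structure IsWeakGradient {N : ℕ} (u : EuclideanSpace ℝ (Fin N) → ℝ)
    (G : EuclideanSpace ℝ (Fin N) → EuclideanSpace ℝ (Fin N)) : Prop where
  locallyIntegrable : LocallyIntegrable u volume
  locallyIntegrable_grad : LocallyIntegrable G volume
  integral_eq : ∀ φ : EuclideanSpace ℝ (Fin N) → ℝ, ContDiff ℝ ∞ φ → HasCompactSupport φ →
    ∀ e : EuclideanSpace ℝ (Fin N),
      ∫ x, u x * fderiv ℝ φ x e = - ∫ x, φ x * inner ℝ (G x) e

/-- `u` decays to zero at infinity in the measure-theoretic sense: all its superlevel sets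
`{|u| > t}`, `t > 0`, have finite Lebesgue measure. -/
def DecaysAtInfinity {N : ℕ} (u : EuclideanSpace ℝ (Fin N) → ℝ) : Prop :=
  ∀ t : ℝ, 0 < t → volume {x | t < |u x|} < ⊤

/-- Distribution function `μ_f(s) = |{|f| > s}|`. -/
def distribution {N : ℕ} (f : EuclideanSpace ℝ (Fin N) → ℝ) (s : ℝ) : ℝ≥0∞ :=
  volume {x | s < |f x|}

/-- Decreasing rearrangement `f^*(t) = inf {s > 0 : μ_f(s) ≤ t}`, with values in `[0, ∞]`. -/
def decreasingRearrangement {N : ℕ} (f : EuclideanSpace ℝ (Fin N) → ℝ) (t : ℝ) : ℝ≥0∞ :=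
  ⨅ (s : ℝ) (_ : 0 < s ∧ distribution f s ≤ ENNReal.ofReal t), ENNReal.ofReal s

/-- Lorentz norm `‖f‖_{L^{r,q}}` for finite positive `r` and `q`. -/
def lorentzNorm {N : ℕ} (r q : ℝ) (f : EuclideanSpace ℝ (Fin N) → ℝ) : ℝ≥0∞ :=
  (∫⁻ t in Ioi (0 : ℝ),
    (ENNReal.ofReal (t ^ (1 / r)) * decreasingRearrangement f t) ^ q / ENNReal.ofReal t) ^ (1 / q)

/-- Marcinkiewicz (weak Lebesgue) quasi-norm `‖f‖_{L^{r,∞}}` for finite positive `r`. -/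
def weakNorm {N : ℕ} (r : ℝ) (f : EuclideanSpace ℝ (Fin N) → ℝ) : ℝ≥0∞ :=
  ⨆ (t : ℝ) (_ : 0 < t), ENNReal.ofReal (t ^ (1 / r)) * decreasingRearrangement f t

/-- Critical Sobolev exponent `p^* = N p / (N - p)`. -/
def sobolevExponent (N : ℕ) (p : ℝ) : ℝ := N * p / (N - p)

/-- Virtual extremal `v_a(x) = a |x|^{-(N-p)/p}`. -/
def virtualExtremal (N : ℕ) (p a : ℝ) (x : EuclideanSpace ℝ (Fin N)) : ℝ :=
  a * ‖x‖ ^ (-((N - p) / p))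

/-- Scale-invariant distance
`d_p(u) = inf_a ‖u - v_a‖_{L^{p^*,∞}} / ‖u‖_{L^{p^*,p}}` to the family of virtual extremals. -/
def hardyDistance {N : ℕ} (p : ℝ) (u : EuclideanSpace ℝ (Fin N) → ℝ) : ℝ≥0∞ :=
  ⨅ a : ℝ, weakNorm (sobolevExponent N p) (fun x => u x - virtualExtremal N p a x) /
    lorentzNorm (sobolevExponent N p) p u

/-- Hardy potential term `∫ |u|^p / |x|^p`. -/
def hardyIntegral {N : ℕ} (p : ℝ) (u : EuclideanSpace ℝ (Fin N) → ℝ) : ℝ :=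
  ∫ x, |u x| ^ p / ‖x‖ ^ p

/-- Hardy deficit `δ_p(u) = ∫ |∇u|^p - ((N-p)/p)^p ∫ |u|^p / |x|^p`, with `G = ∇u`. -/
def hardyDeficit {N : ℕ} (p : ℝ) (u : EuclideanSpace ℝ (Fin N) → ℝ)
    (G : EuclideanSpace ℝ (Fin N) → EuclideanSpace ℝ (Fin N)) : ℝ :=
  (∫ x, ‖G x‖ ^ p) - ((N - p) / p) ^ p * hardyIntegral p u

end HardyStability

end

/-! The distance is estimated with `a = 0` only. With `W` the weak norm and `L` the Lorentz norm of
`u`, one has `d_p(u) ≤ W / L ≤ 1`, and the proof shows `W ^ (2p) ≤ C · deficit · energy`. This gives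
the exponent `2p`; any larger exponent follows because the ratio is at most 1. Heuristically, a
function with small deficit resembles a virtual extremal over a long range of scales, so each level
carries only a small share of its energy. The weak norm sees one level at a time, whereas the
Lorentz norm adds them all.

For a test function `f` put `A = ∇f`, `c = (d - p) / p` with `d` the dimension, and `B = -c f x /
|x|²`, which would be the gradient of `f` if `f` were a virtual extremal. A quantitative convexity
inequality for `|·|^p` at `B` has a cross term which is a radial derivative of `|f|^p`. Integrating
it against `|x|^(-p)` turns it into a multiple of the Hardy integral, and the choice of `c` makes
the deficit bound the second-order remainder `∫ (|B| + |A - B|)^(p-2) |A - B|²`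
(`exists_hardy_remainder`). By Young's inequality the first-order remainder `J = ∫ |A - B| (|B| + |A
- B|)^(p-1)` is then at most `t · deficit + C · energy / t` for every `t > 0`
(`exists_first_order_remainder`).

Localization comes from a weight concentrated where `|f|` is comparable to `s`. Testing the same
divergence identity with `|f|^p f² / (s² + f²)` bounds the localized integral of `|B|^p` by `J`
(`integral_hardyField_levelWeight_le`), hence also the localized energy. The Sobolev inequality for
a smooth truncation of `f` at height `s` bounds `s^p |{|f| > s}|^(p/p*)` by that localized energy
(`rpow_mul_distribution_le_levelWeight`). A supremum over `s` gives the weak-norm estimate, and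
integration in `ds/s` gives the Lorentz–Sobolev inequality.

To reach general `u`, these bounds are collected in `EnergyBounds` with lower semicontinuous
quantities on the left and a multiple of the energy on the right. This is why the geometric mean is
kept in a form linear in the deficit: the Hardy term moves to the left, and Fatou's lemma applies
without convergence of the deficits. Finally a rearrangement argument bounds the Hardy integral by
`L ^ p`, and the algebra is done in `deficit_ge_of_energy_bounds`. -/

noncomputable section

/-! ### Quantitative convexity of the `p`-th power of the norm. -/

section Pointwise

/-- Second-order lower bound for the scalar Bregman divergence of `a ↦ a ^ p` at `1`, `1 < p < 2`. -/
theorem rpow_sub_tangent_ge {p : ℝ} (hp : 1 < p) (hp2 : p < 2) {a T : ℝ} (ha : 0 ≤ a)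
    (haT : a ≤ T) (hT : 1 ≤ T) :
    p * (p - 1) / 2 * T ^ (p - 2) * (a - 1) ^ 2 ≤ a ^ p + (p - 1) - p * a := by
  set m := (p - 1) * T ^ (p - 2) with hm
  have hT0 : 0 < T := by linarith
  have hTle : T ^ (p - 2) ≤ 1 := Real.rpow_le_one_of_one_le_of_nonpos hT (by linarith)
  have hTpos : 0 < T ^ (p - 2) := Real.rpow_pos_of_pos hT0 _
  -- The sign of `K'` is that of `(x ^ (p - 1) - 1) - m * (x - 1)`. It is found from Bernoulli's
  -- inequality with exponent `p - 1 < 1`, applied at `x` below 1 and at `x⁻¹` above 1.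
  let K : ℝ → ℝ := fun x => x ^ p + (p - 1) - p * x - p * m / 2 * (x - 1) ^ 2
  have hK : ∀ x, HasDerivAt K (p * ((x ^ (p - 1) - 1) - m * (x - 1))) x := by
    intro x
    have h1 : HasDerivAt (fun x : ℝ => x ^ p) (p * x ^ (p - 1)) x :=
      Real.hasDerivAt_rpow_const (Or.inr hp.le)
    have h2 : HasDerivAt (fun x : ℝ => (x - 1) ^ 2) (2 * (x - 1)) x := by
      exact (((hasDerivAt_id x).sub_const 1).fun_pow 2).congr_deriv (by simp)
    have h3 : HasDerivAt (fun x : ℝ => p * x) p x := by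
      simpa using (hasDerivAt_id x).const_mul p
    exact (((h1.add_const (p - 1)).fun_sub h3).fun_sub (h2.const_mul (p * m / 2))).congr_deriv
      (by ring)
  have hKd : Differentiable ℝ K := fun x => (hK x).differentiableAt
  have hK1 : K 1 = 0 := by simp [K]
  suffices 0 ≤ K a by simp only [K, hm] at this; nlinarith
  rcases le_total a 1 with h | h
  · have : AntitoneOn K (Icc 0 1) := by
      refine antitoneOn_of_deriv_nonpos (convex_Icc 0 1) hKd.continuous.continuousOn
        hKd.differentiableOn ?_
      intro x hx
      rw [interior_Icc] at hx
      rw [(hK x).deriv]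
      have : x ^ (p - 1) ≤ 1 + (p - 1) * (x - 1) := by
        have := rpow_one_add_le_one_add_mul_self (s := x - 1) (by linarith [hx.1])
          (p := p - 1) (by linarith) (by linarith)
        simpa using this
      have h2 : m ≤ p - 1 := by rw [hm]; nlinarith
      have : x ^ (p - 1) - 1 - m * (x - 1) ≤ 0 := by nlinarith [hx.2]
      nlinarith
    rw [← hK1]
    exact this ⟨ha, h⟩ ⟨by norm_num, le_rfl⟩ h
  · have : MonotoneOn K (Icc 1 T) := by
      refine monotoneOn_of_deriv_nonneg (convex_Icc 1 T) hKd.continuous.continuousOn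
        hKd.differentiableOn ?_
      intro x hx
      rw [interior_Icc] at hx
      rw [(hK x).deriv]
      have hx0 : 0 < x := by linarith [hx.1]
      have h1 : (x⁻¹) ^ (p - 1) ≤ 1 + (p - 1) * (x⁻¹ - 1) := by
        have := rpow_one_add_le_one_add_mul_self (s := x⁻¹ - 1)
          (by linarith [inv_pos.2 hx0]) (p := p - 1) (by linarith) (by linarith)
        simpa using this
      have h2 : 1 ≤ x ^ (p - 1) * (1 + (p - 1) * (x⁻¹ - 1)) := by
        calc 1 = x ^ (p - 1) * (x⁻¹) ^ (p - 1) := by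
              rw [← Real.mul_rpow hx0.le (inv_pos.2 hx0).le, mul_inv_cancel₀ hx0.ne',
                Real.one_rpow]
          _ ≤ _ := by gcongr
      have h3 : x ^ (p - 1) = x ^ (p - 2) * x := by
        rw [← Real.rpow_add_one hx0.ne']; ring_nf
      have h4 : x ^ (p - 1) * (1 + (p - 1) * (x⁻¹ - 1)) =
          x ^ (p - 1) - (p - 1) * (x ^ (p - 2) * (x - 1)) := by
        rw [h3]; field_simp; ring
      have h5 : T ^ (p - 2) ≤ x ^ (p - 2) :=
        Real.rpow_le_rpow_of_nonpos hx0 hx.2.le (by linarith)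
      have h6 : m * (x - 1) ≤ (p - 1) * (x ^ (p - 2) * (x - 1)) := by
        rw [hm, mul_assoc]
        have : 0 ≤ x - 1 := by linarith [hx.1]
        have : 0 ≤ p - 1 := by linarith
        gcongr
      have : 0 ≤ x ^ (p - 1) - 1 - m * (x - 1) := by linarith
      positivity
    rw [← hK1]
    exact this ⟨le_rfl, hT⟩ ⟨h, haT⟩ h

/-- Scalar form of the lower bound for the Bregman divergence of `‖·‖ ^ p` at a unit vector. -/
theorem exists_bregman_scalar {p : ℝ} (hp : 1 < p) :
    ∃ c : ℝ, 0 < c ∧ c ≤ 1 ∧ ∀ α y β : ℝ, 0 ≤ α → 0 ≤ y → |β| ≤ y → α ^ 2 = 1 + 2 * β + y ^ 2 →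
      1 + p * β + c * ((1 + y) ^ (p - 2) * y ^ 2) ≤ α ^ p := by
  rcases lt_or_ge p 2 with h2 | h2
  · refine ⟨p * (p - 1) / 2, by nlinarith, by nlinarith, fun α y β hα hy hβ h => ?_⟩
    obtain ⟨hβ1, hβ2⟩ := abs_le.1 hβ
    have hα1 : α ≤ 1 + y := by nlinarith
    have hs := rpow_sub_tangent_ge hp h2 hα hα1 (by linarith)
    have hle : (1 + y) ^ (p - 2) ≤ 1 :=
      Real.rpow_le_one_of_one_le_of_nonpos (by linarith) (by linarith)
    have hpos : 0 < (1 + y) ^ (p - 2) := by positivity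
    -- The tangent bound produces `(α - 1) ^ 2` where `y ^ 2` is wanted. The gap is paid by the
    -- linear term, since `α - 1 = β + (y ^ 2 - (α - 1) ^ 2) / 2` and the quadratic coefficient is
    -- at most `p / 2`.
    have hd : (α - 1) ^ 2 ≤ y ^ 2 := by nlinarith
    have h3 : p * (p - 1) / 2 * (1 + y) ^ (p - 2) ≤ p / 2 := by
      have : p * (p - 1) / 2 * (1 + y) ^ (p - 2) ≤ p * (p - 1) / 2 * 1 := by
        have : 0 ≤ p * (p - 1) / 2 := by nlinarith
        gcongr
      nlinarith
    nlinarith [mul_le_mul_of_nonneg_right h3 (sub_nonneg.2 hd)]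
  · have h3pos : (0 : ℝ) < 3 ^ (-p) := by positivity
    -- With this constant the quadratic term is at most `((1 + y) / 3) ^ p`. For `y ≤ 2` the factor
    -- `3 ^ (-p) * (1 + y) ^ (p - 2)` is at most 1, so Bernoulli suffices. For `y ≥ 2` one has `(1 +
    -- y) / 3 ≤ y - 1`.
    refine ⟨3 ^ (-p), h3pos, Real.rpow_le_one_of_one_le_of_nonpos (by norm_num) (by linarith),
      fun α y β hα hy hβ h => ?_⟩
    obtain ⟨hβ1, hβ2⟩ := abs_le.1 hβ
    have hαp : α ^ p = (1 + (2 * β + y ^ 2)) ^ (p / 2) := by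
      rw [← add_assoc, ← h, ← Real.rpow_natCast, ← Real.rpow_mul hα]; congr 1; push_cast; ring
    have hmain : 3 ^ (-p) * ((1 + y) ^ (p - 2) * y ^ 2) ≤ ((1 + y) / 3) ^ p := by
      have e1 : ((1 + y) / 3) ^ p = 3 ^ (-p) * ((1 + y) ^ (p - 2) * (1 + y) ^ 2) := by
        rw [Real.div_rpow (by positivity) (by norm_num), Real.rpow_neg (by norm_num),
          ← Real.rpow_natCast (1 + y) 2, ← Real.rpow_add (by positivity)]
        push_cast
        rw [sub_add_cancel]; field_simp
      rw [e1]; gcongr; linarith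
    rcases le_total y 2 with hy2 | hy2
    · have hb := one_add_mul_self_le_rpow_one_add (s := 2 * β + y ^ 2) (by nlinarith)
        (p := p / 2) (by linarith)
      have h4 : (3 : ℝ) ^ (-p) * (1 + y) ^ (p - 2) ≤ 1 := by
        calc (3 : ℝ) ^ (-p) * (1 + y) ^ (p - 2) ≤ 3 ^ (-p) * 3 ^ (p - 2) := by
              gcongr; linarith
          _ = 3 ^ (-2 : ℝ) := by rw [← Real.rpow_add (by norm_num)]; congr 1; ring
          _ ≤ 1 := Real.rpow_le_one_of_one_le_of_nonpos (by norm_num) (by norm_num)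
      rw [hαp]
      nlinarith [mul_le_mul_of_nonneg_right h4 (sq_nonneg y), sq_nonneg y]
    · rcases le_total 0 (1 + 2 * β) with h5 | h5
      · have hb := one_add_mul_self_le_rpow_one_add (s := 2 * β) (by linarith)
          (p := p / 2) (by linarith)
        have h6 := Real.add_rpow_le_rpow_add h5 (sq_nonneg y) (p := p / 2) (by linarith)
        have h7 : (y ^ 2) ^ (p / 2) = y ^ p := by
          rw [← Real.rpow_natCast, ← Real.rpow_mul hy]; congr 1; push_cast; ring
        have h8 : ((1 + y) / 3) ^ p ≤ y ^ p := by gcongr; linarith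
        rw [hαp, ← add_assoc]
        linarith
      -- Here `1 + 2 * β ≤ 0` and `p ≥ 2` make `1 + p * β` nonpositive, so only the last term has to
      -- be bounded.
      · have h6 : (1 + y) / 3 ≤ α := by
          have : y - 1 ≤ α := abs_le_of_sq_le_sq' (by nlinarith) hα |>.2
          linarith
        have h7 : ((1 + y) / 3) ^ p ≤ α ^ p := by gcongr
        nlinarith

/-- Quantitative strict convexity of `‖·‖ ^ p`, uniformly in all `p > 1`. -/
theorem exists_bregman_norm_rpow {p : ℝ} (hp : 1 < p) (E : Type*) [NormedAddCommGroup E]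
    [InnerProductSpace ℝ E] :
    ∃ c : ℝ, 0 < c ∧ ∀ A B : E,
      ‖B‖ ^ p + p * ‖B‖ ^ (p - 2) * inner ℝ B (A - B) +
        c * ((‖B‖ + ‖A - B‖) ^ (p - 2) * ‖A - B‖ ^ 2) ≤ ‖A‖ ^ p := by
  obtain ⟨c, hc, hc1, h⟩ := exists_bregman_scalar hp
  refine ⟨c, hc, fun A B => ?_⟩
  rcases eq_or_ne B 0 with rfl | hB
  · simp only [norm_zero, inner_zero_left, mul_zero, add_zero, sub_zero, zero_add,
      Real.zero_rpow (by linarith : p ≠ 0)]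
    rcases eq_or_ne A 0 with rfl | hA
    · simp [Real.zero_rpow (by linarith : p ≠ 0)]
    · have hA' : 0 < ‖A‖ := norm_pos_iff.2 hA
      have : ‖A‖ ^ p = ‖A‖ ^ (p - 2) * ‖A‖ ^ 2 := by
        rw [← Real.rpow_natCast ‖A‖ 2, ← Real.rpow_add hA']; push_cast; rw [sub_add_cancel]
      rw [this]
      exact mul_le_of_le_one_left (by positivity) hc1
  · have hb : 0 < ‖B‖ := norm_pos_iff.2 hB
    set b := ‖B‖ with hbdef
    have key := h (‖A‖ / b) (‖A - B‖ / b) (inner ℝ B (A - B) / b ^ 2) (by positivity)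
      (by positivity) ?_ ?_
    · have e1 : ‖A‖ ^ p = b ^ p * (‖A‖ / b) ^ p := by
        rw [← Real.mul_rpow hb.le (by positivity)]; congr 1; field_simp
      have e2 : (b + ‖A - B‖) ^ (p - 2) = b ^ (p - 2) * (1 + ‖A - B‖ / b) ^ (p - 2) := by
        rw [← Real.mul_rpow hb.le (by positivity)]; congr 1; field_simp
      have e3 : b ^ p = b ^ (p - 2) * b ^ 2 := by
        rw [← Real.rpow_natCast b 2, ← Real.rpow_add hb]; push_cast; rw [sub_add_cancel]
      have hbp : 0 < b ^ (p - 2) := by positivity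
      have := mul_le_mul_of_nonneg_left key (by positivity : 0 ≤ b ^ p)
      rw [e1, e2]
      refine le_trans (le_of_eq ?_) this
      rw [e3]
      field_simp
    · rw [abs_div, abs_of_pos (by positivity : 0 < b ^ 2), div_le_div_iff₀ (by positivity) hb]
      nlinarith [abs_real_inner_le_norm B (A - B), norm_nonneg (A - B)]
    · have e : ‖A‖ ^ 2 = b ^ 2 + 2 * inner ℝ B (A - B) + ‖A - B‖ ^ 2 := by
        have := norm_add_sq_real B (A - B)
        rwa [add_sub_cancel] at this
      rw [div_pow, e]; field_simp

end Pointwise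

/-! ### The distributional divergence of `x / ‖x‖ ^ p`, obtained by scaling. -/

section Radial

open Module Filter Topology

variable {E : Type*} [NormedAddCommGroup E] [InnerProductSpace ℝ E] [FiniteDimensional ℝ E]
  [MeasurableSpace E] [BorelSpace E] (μ : Measure E) [μ.IsAddHaarMeasure]

theorem locallyIntegrable_norm_rpow_neg {p : ℝ} (hp : 0 < p) (hd : p < finrank ℝ E) :
    LocallyIntegrable (fun x : E => ‖x‖ ^ (-p)) μ := by
  refine locallyIntegrable_of_norm_le_rpow (C := 1) (α := p) ?_ hd (.of_forall fun x => ?_) ?_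
  · have : (0 : ℝ) < finrank ℝ E := hp.trans hd
    exact_mod_cast this
  · rw [one_mul, Real.norm_of_nonneg (by positivity)]
  · exact (measurable_norm.pow_const _).aestronglyMeasurable

theorem integrable_norm_rpow_neg_mul {p : ℝ} (hp : 0 < p) (hd : p < finrank ℝ E) {g : E → ℝ}
    (hg : Continuous g) (hgs : HasCompactSupport g) :
    Integrable (fun x : E => ‖x‖ ^ (-p) * g x) μ :=
  (locallyIntegrable_norm_rpow_neg μ hp hd).integrable_smul_right_of_hasCompactSupport hg hgs

/-- The vector field `x / ‖x‖ ^ p` has distributional divergence `(d - p) / ‖x‖ ^ p`. -/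
theorem integral_norm_rpow_neg_mul_fderiv {p : ℝ} (hp : 0 < p) (hd : p < finrank ℝ E) {Ψ : E → ℝ}
    (hΨ : ContDiff ℝ 1 Ψ) (hs : HasCompactSupport Ψ) :
    ∫ x, ‖x‖ ^ (-p) * fderiv ℝ Ψ x x ∂μ = -(finrank ℝ E - p) * ∫ x, ‖x‖ ^ (-p) * Ψ x ∂μ := by
  set d := finrank ℝ E
  -- Instead of excising a ball around the origin, the dilates `Ψ (t • x)` are integrated. A change
  -- of variables gives the factor `t ^ (p - d)`, and the identity is the derivative at `t = 1`
  -- computed in two ways.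
  let F : ℝ → E → ℝ := fun t x => ‖x‖ ^ (-p) * Ψ (t • x)
  let F' : ℝ → E → ℝ := fun t x => ‖x‖ ^ (-p) * fderiv ℝ Ψ (t • x) x
  obtain ⟨R, hR0, hR⟩ := hs.isCompact.isBounded.exists_pos_norm_lt
  obtain ⟨M, hM⟩ := (hs.fderiv ℝ).exists_bound_of_continuous (hΨ.continuous_fderiv one_ne_zero)
  have hM0 : 0 ≤ M := (norm_nonneg _).trans (hM 0)
  have hmeas : Measurable fun x : E => ‖x‖ ^ (-p) := measurable_norm.pow_const _
  have hsc : ∀ t : ℝ, 0 < t → HasCompactSupport fun x : E => Ψ (t • x) := fun t ht =>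
    hs.comp_smul ht.ne'
  have hF : ∀ t : ℝ, 0 < t → ∫ x, F t x ∂μ = t ^ (p - d) * ∫ x, F 1 x ∂μ := by
    intro t ht
    have h1 : ∀ x, F t x = t ^ p * (‖t • x‖ ^ (-p) * Ψ (t • x)) := by
      intro x
      simp only [F]
      rw [norm_smul, Real.norm_of_nonneg ht.le, Real.mul_rpow ht.le (norm_nonneg _), ← mul_assoc,
        ← mul_assoc, ← Real.rpow_add ht]
      simp
    simp_rw [h1]
    rw [integral_const_mul, Measure.integral_comp_smul_of_nonneg μ
      (fun x => ‖x‖ ^ (-p) * Ψ x) t (hR := ht.le), smul_eq_mul, ← mul_assoc, Real.rpow_sub ht,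
      Real.rpow_natCast, div_eq_mul_inv]
    simp [F, d]
  have hder1 : HasDerivAt (fun t => ∫ x, F t x ∂μ) ((p - d) * ∫ x, F 1 x ∂μ) 1 := by
    have := (Real.hasDerivAt_rpow_const (x := 1) (p := p - d) (Or.inl one_ne_zero)).mul_const
      (∫ x, F 1 x ∂μ)
    simp only [Real.one_rpow, mul_one] at this
    refine this.congr_of_eventuallyEq ?_
    filter_upwards [lt_mem_nhds (show (0 : ℝ) < 1 by norm_num)] with t ht using hF t ht
  -- For `t > 1/2` every dilate is supported in the ball of radius `2 * R`, where `‖x‖ ^ (-p)` is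
  -- integrable because `p < d`.
  have hder2 := (hasDerivAt_integral_of_dominated_loc_of_deriv_le (μ := μ) (F := F) (F' := F')
    (x₀ := 1) (s := Ioi (1 / 2 : ℝ))
    (bound := (Metric.ball (0 : E) (2 * R)).indicator fun x => ‖x‖ ^ (-p) * (M * (2 * R)))
    (Ioi_mem_nhds (by norm_num)) ?_ ?_ ?_ ?_ ?_ ?_).2
  · have := hder2.unique hder1
    simp only [F, F', one_smul] at this
    rw [this]; ring
  · refine .of_forall fun t => ?_
    exact (hmeas.mul (hΨ.continuous.comp (continuous_const_smul t)).measurable).aestronglyMeasurable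
  · exact integrable_norm_rpow_neg_mul μ hp hd (hΨ.continuous.comp (continuous_const_smul 1))
      (hsc 1 one_pos)
  · refine (hmeas.mul (Continuous.measurable ?_)).aestronglyMeasurable
    exact ((hΨ.continuous_fderiv one_ne_zero).comp (continuous_const_smul (1 : ℝ))).clm_apply
      continuous_id
  · refine .of_forall fun x t ht => ?_
    have ht : 1 / 2 < t := ht
    by_cases hx : x ∈ Metric.ball (0 : E) (2 * R)
    · rw [indicator_of_mem hx]
      simp only [F', norm_mul]
      rw [Real.norm_of_nonneg (by positivity : 0 ≤ ‖x‖ ^ (-p))]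
      gcongr
      refine (ContinuousLinearMap.le_opNorm _ _).trans ?_
      gcongr
      · exact hM _
      · exact (mem_ball_zero_iff.1 hx).le
    · have hx' : 2 * R ≤ ‖x‖ := by simpa using hx
      have : t • x ∉ tsupport Ψ := by
        intro h
        have := hR _ h
        rw [norm_smul, Real.norm_of_nonneg (by linarith)] at this
        nlinarith
      have h0 : fderiv ℝ Ψ (t • x) = 0 := by
        by_contra h
        exact this (support_fderiv_subset ℝ h)
      rw [indicator_of_notMem hx]
      simp [F', h0]
  · rw [integrable_indicator_iff measurableSet_ball]
    exact (((locallyIntegrable_norm_rpow_neg μ hp hd).integrableOn_isCompact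
      (isCompact_closedBall 0 (2 * R))).mono_set Metric.ball_subset_closedBall).mul_const _
  · refine .of_forall fun x t _ => ?_
    have h1 : HasDerivAt (fun t : ℝ => t • x) x t := by
      simpa using (hasDerivAt_id t).smul_const x
    have h2 := ((hΨ.differentiable one_ne_zero) (t • x)).hasFDerivAt.comp_hasDerivAt t h1
    exact h2.const_mul _

end Radial

/-! ### Hardy's inequality with second-order and first-order remainders. -/

section HardyRemainder

set_option linter.unusedSectionVars false

open Module Filter Topology

variable {E : Type*} [NormedAddCommGroup E] [InnerProductSpace ℝ E]

/-- The gradient a function would have if it were a multiple of the virtual extremal. -/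
def hardyField (c : ℝ) (f : E → ℝ) (x : E) : E := -(c * f x / ‖x‖ ^ 2) • x

theorem norm_hardyField {c : ℝ} (hc : 0 ≤ c) (f : E → ℝ) (x : E) :
    ‖hardyField c f x‖ = c * |f x| / ‖x‖ := by
  rcases eq_or_ne x 0 with rfl | hx
  · simp [hardyField]
  · have : 0 < ‖x‖ := norm_pos_iff.2 hx
    rw [hardyField, norm_smul, norm_neg, norm_div, norm_mul, Real.norm_of_nonneg hc,
      Real.norm_eq_abs, norm_pow, norm_norm]
    field_simp

theorem norm_hardyField_rpow {c p : ℝ} (hc : 0 ≤ c) (f : E → ℝ) (x : E) :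
    ‖hardyField c f x‖ ^ p = c ^ p * (‖x‖ ^ (-p) * |f x| ^ p) := by
  rw [norm_hardyField hc, Real.div_rpow (by positivity) (by positivity),
    Real.mul_rpow hc (by positivity), Real.rpow_neg (norm_nonneg _)]
  ring

variable [CompleteSpace E]

theorem norm_gradient (f : E → ℝ) (x : E) : ‖gradient f x‖ = ‖fderiv ℝ f x‖ :=
  LinearIsometryEquiv.norm_map _ _

/-- The cross term of the convexity inequality is a radial derivative of `|f| ^ p`, so the
divergence identity can integrate it. At the origin and on the zero set of `f` both sides vanish. -/
theorem inner_hardyField_gradient {c p : ℝ} (hc : 0 < c) (hp : 1 < p) {f : E → ℝ}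
    (hf : Differentiable ℝ f) (x : E) :
    p * ‖hardyField c f x‖ ^ (p - 2) * inner ℝ (hardyField c f x) (gradient f x) =
      -c ^ (p - 1) * (‖x‖ ^ (-p) * fderiv ℝ (fun y => |f y| ^ p) x x) := by
  have hD : fderiv ℝ (fun y => |f y| ^ p) x x = p * |f x| ^ (p - 2) * f x * fderiv ℝ f x x := by
    have := ((hasDerivAt_abs_rpow (f x) hp).comp_hasFDerivAt x (hf x).hasFDerivAt).fderiv
    simp only [Function.comp_def] at this
    rw [this]; simp
  rw [hD]
  rcases eq_or_ne x 0 with rfl | hx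
  · simp [hardyField]
  rcases eq_or_ne (f x) 0 with h0 | h0
  · simp [hardyField, h0]
  have hr : 0 < ‖x‖ := norm_pos_iff.2 hx
  have ha : 0 < |f x| := abs_pos.2 h0
  rw [norm_hardyField hc.le, hardyField, inner_smul_left, real_inner_comm, inner_gradient_left,
    Real.div_rpow (by positivity) hr.le, Real.mul_rpow hc.le ha.le, Real.rpow_neg hr.le]
  have e1 : c ^ (p - 1) = c ^ (p - 2) * c := by
    rw [← Real.rpow_add_one hc.ne']; congr 1; ring
  have e2 : ‖x‖ ^ p = ‖x‖ ^ (p - 2) * ‖x‖ ^ 2 := by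
    rw [← Real.rpow_natCast ‖x‖ 2, ← Real.rpow_add hr]; push_cast; rw [sub_add_cancel]
  have : 0 < ‖x‖ ^ (p - 2) := by positivity
  rw [e1, e2]
  simp only [conj_trivial]
  field_simp

theorem continuous_gradient {f : E → ℝ} (hf : ContDiff ℝ 1 f) : Continuous (gradient f) :=
  (InnerProductSpace.toDual ℝ E).symm.continuous.comp (hf.continuous_fderiv one_ne_zero)

variable [FiniteDimensional ℝ E] [MeasurableSpace E] [BorelSpace E] (μ : Measure E)
  [μ.IsAddHaarMeasure]

theorem measurable_hardyField {c : ℝ} {f : E → ℝ} (hf : Continuous f) :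
    Measurable (hardyField c f) := by
  unfold hardyField
  exact (((hf.measurable.const_mul c).div (measurable_norm.pow_const 2)).neg).smul measurable_id

theorem integrable_norm_gradient_rpow {p : ℝ} (hp : 0 < p) {f : E → ℝ} (hf : ContDiff ℝ 1 f)
    (hs : HasCompactSupport f) : Integrable (fun x => ‖gradient f x‖ ^ p) μ := by
  refine Continuous.integrable_of_hasCompactSupport
    ((continuous_gradient hf).norm.rpow_const fun _ => Or.inr hp.le) ?_
  simp_rw [norm_gradient]
  exact (hs.fderiv ℝ).comp_left (g := fun y : E →L[ℝ] ℝ => ‖y‖ ^ p)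
    (by simp [Real.zero_rpow hp.ne'])

theorem integrable_norm_hardyField_rpow {c p : ℝ} (hc : 0 ≤ c) (hp : 0 < p)
    (hd : p < finrank ℝ E) {f : E → ℝ} (hf : Continuous f) (hs : HasCompactSupport f) :
    Integrable (fun x => ‖hardyField c f x‖ ^ p) μ := by
  simp_rw [norm_hardyField_rpow hc]
  refine (integrable_norm_rpow_neg_mul μ hp hd (hf.abs.rpow_const fun _ => Or.inr hp.le)
    ?_).const_mul _
  exact hs.comp_left (g := fun y : ℝ => |y| ^ p) (by simp [Real.zero_rpow hp.ne'])

/-- Hardy inequality with a remainder term, for test functions. -/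
theorem exists_hardy_remainder {p : ℝ} (hp : 1 < p) (hd : p < finrank ℝ E) :
    ∃ κ : ℝ, 0 < κ ∧ ∀ f : E → ℝ, ContDiff ℝ 1 f → HasCompactSupport f →
      ∀ c : ℝ, c = (finrank ℝ E - p) / p →
      Integrable (fun x => (‖hardyField c f x‖ + ‖gradient f x - hardyField c f x‖) ^ (p - 2) *
        ‖gradient f x - hardyField c f x‖ ^ 2) μ ∧
      (∫ x, ‖hardyField c f x‖ ^ p ∂μ) +
        κ * ∫ x, (‖hardyField c f x‖ + ‖gradient f x - hardyField c f x‖) ^ (p - 2) *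
          ‖gradient f x - hardyField c f x‖ ^ 2 ∂μ ≤ ∫ x, ‖gradient f x‖ ^ p ∂μ := by
  obtain ⟨κ, hκ, hbreg⟩ := exists_bregman_norm_rpow hp E
  refine ⟨κ, hκ, fun f hf hs c hcdef => ?_⟩
  have hp0 : 0 < p := by linarith
  have hc : 0 < c := by rw [hcdef]; exact div_pos (by linarith) hp0
  set B := hardyField c f
  set A := gradient f
  set S : E → ℝ := fun x => (‖B x‖ + ‖A x - B x‖) ^ (p - 2) * ‖A x - B x‖ ^ 2 with hS
  have hΨ : ContDiff ℝ 1 fun y => |f y| ^ p := by simpa using hf.norm_rpow hp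
  have hΨs : HasCompactSupport fun y => |f y| ^ p :=
    hs.comp_left (g := fun y : ℝ => |y| ^ p) (by simp [Real.zero_rpow hp0.ne'])
  have hAi := integrable_norm_gradient_rpow μ hp0 hf hs
  have hBi := integrable_norm_hardyField_rpow μ hc.le hp0 hd hf.continuous hs
  have hDi : Integrable (fun x => ‖x‖ ^ (-p) * fderiv ℝ (fun y => |f y| ^ p) x x) μ := by
    refine integrable_norm_rpow_neg_mul μ hp0 hd
      ((hΨ.continuous_fderiv one_ne_zero).clm_apply continuous_id) ?_
    refine (hΨs.fderiv ℝ).mono ?_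
    intro x hx h
    exact hx (by simp [h])
  have hS0 : ∀ x, 0 ≤ S x := fun x => by positivity
  -- This domination also supplies the integrability of `S`, which is not evident beforehand when `p
  -- < 2`.
  have hpt : ∀ x, κ * S x ≤ ‖A x‖ ^ p + (p - 1) * ‖B x‖ ^ p +
      c ^ (p - 1) * (‖x‖ ^ (-p) * fderiv ℝ (fun y => |f y| ^ p) x x) := by
    intro x
    have h1 := hbreg (A x) (B x)
    have h2 := inner_hardyField_gradient hc hp (hf.differentiable one_ne_zero) x
    have h3 : p * ‖B x‖ ^ (p - 2) * inner ℝ (B x) (B x) = p * ‖B x‖ ^ p := by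
      rcases eq_or_ne (B x) 0 with h | h
      · simp [h, Real.zero_rpow hp0.ne']
      · rw [real_inner_self_eq_norm_sq, ← Real.rpow_natCast ‖B x‖ 2, mul_assoc,
          ← Real.rpow_add (norm_pos_iff.2 h)]; push_cast; rw [sub_add_cancel]
    rw [inner_sub_right, mul_sub, h2, h3] at h1
    simp only [hS]
    linarith
  have hri : Integrable (fun x => ‖A x‖ ^ p + (p - 1) * ‖B x‖ ^ p +
      c ^ (p - 1) * (‖x‖ ^ (-p) * fderiv ℝ (fun y => |f y| ^ p) x x)) μ :=
    (hAi.add (hBi.const_mul _)).add (hDi.const_mul _)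
  have hAm : Measurable A := (continuous_gradient hf).measurable
  have hBm : Measurable B := measurable_hardyField hf.continuous
  have hSm : Measurable S :=
    ((hBm.norm.add (hAm.sub hBm).norm).pow_const _).mul ((hAm.sub hBm).norm.pow_const 2)
  have hκSi : Integrable (fun x => κ * S x) μ := by
    refine hri.mono' (hSm.const_mul κ).aestronglyMeasurable (.of_forall fun x => ?_)
    rw [Real.norm_of_nonneg (mul_nonneg hκ.le (hS0 x))]
    exact hpt x
  have hSi : Integrable S μ := by
    have := hκSi.const_mul κ⁻¹
    simpa [← mul_assoc, inv_mul_cancel₀ hκ.ne'] using this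
  refine ⟨hSi, ?_⟩
  have hint := integral_mono hκSi hri hpt
  rw [integral_const_mul, integral_add (f := fun x => ‖A x‖ ^ p + (p - 1) * ‖B x‖ ^ p)
      (hAi.add (hBi.const_mul _)) (hDi.const_mul _),
    integral_add hAi (hBi.const_mul _), integral_const_mul, integral_const_mul,
    integral_norm_rpow_neg_mul_fderiv μ hp0 hd hΨ hΨs] at hint
  have hBH : ∫ x, ‖B x‖ ^ p ∂μ = c ^ p * ∫ x, ‖x‖ ^ (-p) * |f x| ^ p ∂μ := by
    rw [← integral_const_mul]
    exact integral_congr_ae (.of_forall fun x => norm_hardyField_rpow hc.le f x)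
  -- The value of `c` enters here: the divergence term equals exactly `-p * ∫ ‖B‖ ^ p`, which leaves
  -- coefficient `-1` after adding `(p - 1) * ∫ ‖B‖ ^ p`.
  have hcp : c ^ (p - 1) * (finrank ℝ E - p) = p * c ^ p := by
    have : (finrank ℝ E : ℝ) - p = c * p := by rw [hcdef]; field_simp
    rw [this, ← sub_add_cancel p 1, Real.rpow_add_one hc.ne']
    simp only [sub_add_cancel]
    ring
  rw [show c ^ (p - 1) * (-((finrank ℝ E : ℝ) - p) * ∫ x, ‖x‖ ^ (-p) * |f x| ^ p ∂μ) =
    -(c ^ (p - 1) * (finrank ℝ E - p)) * ∫ x, ‖x‖ ^ (-p) * |f x| ^ p ∂μ by ring, hcp] at hint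
  have : -(p * c ^ p) * ∫ x, ‖x‖ ^ (-p) * |f x| ^ p ∂μ = -p * ∫ x, ‖B x‖ ^ p ∂μ := by
    rw [hBH]; ring
  rw [this] at hint
  linarith

/-- With `z = b + y`, the difference of the two sides is `z ^ (p - 2) * (2 * τ * y - z) ^ 2 / (4 *
τ)`. This is Cauchy–Schwarz between the second-order remainder and the energy, with a free
parameter. -/
theorem mul_rpow_sub_one_le {p b y τ : ℝ} (hb : 0 ≤ b) (hy : 0 ≤ y) (hτ : 0 < τ) :
    y * (b + y) ^ (p - 1) ≤ τ * ((b + y) ^ (p - 2) * y ^ 2) + (b + y) ^ p / (4 * τ) := by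
  rcases (add_nonneg hb hy).eq_or_lt with h | h
  · have h0 : y = 0 := by linarith
    rw [h0]; simp; positivity
  · set z := b + y
    have e1 : z ^ (p - 1) = z ^ (p - 2) * z := by
      rw [← Real.rpow_add_one h.ne']; congr 1; ring
    have e2 : z ^ p = z ^ (p - 2) * z ^ 2 := by
      rw [← Real.rpow_natCast z 2, ← Real.rpow_add h]; push_cast; rw [sub_add_cancel]
    rw [e1, e2]
    have : 0 < z ^ (p - 2) := by positivity
    have : τ * (z ^ (p - 2) * y ^ 2) + z ^ (p - 2) * z ^ 2 / (4 * τ) - y * (z ^ (p - 2) * z) =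
        z ^ (p - 2) * (2 * τ * y - z) ^ 2 / (4 * τ) := by
      field_simp; ring
    have : 0 ≤ z ^ (p - 2) * (2 * τ * y - z) ^ 2 / (4 * τ) := by positivity
    linarith

theorem add_rpow_le_two_rpow {p a b : ℝ} (hp : 0 ≤ p) (ha : 0 ≤ a) (hb : 0 ≤ b) :
    (a + b) ^ p ≤ 2 ^ p * (a ^ p + b ^ p) := by
  have hm : 0 ≤ max a b := le_max_of_le_left ha
  calc (a + b) ^ p ≤ (2 * max a b) ^ p := by
        gcongr
        linarith [le_max_left a b, le_max_right a b]
    _ = 2 ^ p * (max a b) ^ p := by rw [Real.mul_rpow (by norm_num) hm]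
    _ ≤ _ := by
        gcongr
        rcases max_choice a b with h | h <;> rw [h] <;> linarith [Real.rpow_nonneg ha p,
          Real.rpow_nonneg hb p]

/-- The first-order remainder is controlled by the geometric mean of the Hardy deficit and the
energy, written in linearized form. -/
theorem exists_first_order_remainder {p : ℝ} (hp : 1 < p) (hd : p < finrank ℝ E) :
    ∃ C : ℝ, 0 < C ∧ ∀ f : E → ℝ, ContDiff ℝ 1 f → HasCompactSupport f →
      ∀ c : ℝ, c = (finrank ℝ E - p) / p →
      Integrable (fun x => ‖gradient f x - hardyField c f x‖ *
        (‖hardyField c f x‖ + ‖gradient f x - hardyField c f x‖) ^ (p - 1)) μ ∧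
      (∫ x, ‖hardyField c f x‖ ^ p ∂μ ≤ ∫ x, ‖gradient f x‖ ^ p ∂μ) ∧
      ∀ t : ℝ, 0 < t → (∫ x, ‖gradient f x - hardyField c f x‖ *
        (‖hardyField c f x‖ + ‖gradient f x - hardyField c f x‖) ^ (p - 1) ∂μ) +
          t * ∫ x, ‖hardyField c f x‖ ^ p ∂μ ≤ (t + C / t) * ∫ x, ‖gradient f x‖ ^ p ∂μ := by
  obtain ⟨κ, hκ, h⟩ := exists_hardy_remainder μ hp hd
  refine ⟨4 ^ p / κ, by positivity, fun f hf hs c hcdef => ?_⟩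
  obtain ⟨hSi, hle⟩ := h f hf hs c hcdef
  have hp0 : 0 < p := by linarith
  have hc : 0 < c := by rw [hcdef]; exact div_pos (by linarith) hp0
  have hAi := integrable_norm_gradient_rpow μ hp0 hf hs
  have hBi := integrable_norm_hardyField_rpow μ hc.le hp0 hd hf.continuous hs
  set B := hardyField c f
  set A := gradient f
  have hAm : Measurable A := (continuous_gradient hf).measurable
  have hBm : Measurable B := measurable_hardyField hf.continuous
  have hzle : ∀ x, (‖B x‖ + ‖A x - B x‖) ^ p ≤ 4 ^ p * (‖A x‖ ^ p + ‖B x‖ ^ p) := by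
    intro x
    calc (‖B x‖ + ‖A x - B x‖) ^ p ≤ (2 * (‖A x‖ + ‖B x‖)) ^ p := by
          gcongr
          linarith [norm_sub_le (A x) (B x), norm_nonneg (A x)]
      _ = 2 ^ p * (‖A x‖ + ‖B x‖) ^ p := by
          rw [Real.mul_rpow (by norm_num) (by positivity)]
      _ ≤ 2 ^ p * (2 ^ p * (‖A x‖ ^ p + ‖B x‖ ^ p)) := by
          gcongr
          exact add_rpow_le_two_rpow hp0.le (norm_nonneg _) (norm_nonneg _)
      _ = _ := by
          rw [← mul_assoc, ← Real.mul_rpow (by norm_num) (by norm_num)]; norm_num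
  have hzi : Integrable (fun x => (‖B x‖ + ‖A x - B x‖) ^ p) μ := by
    refine ((hAi.add hBi).const_mul (4 ^ p)).mono'
      ((hBm.norm.add (hAm.sub hBm).norm).pow_const _).aestronglyMeasurable (.of_forall fun x => ?_)
    rw [Real.norm_of_nonneg (by positivity)]
    exact hzle x
  have hJ0 : ∀ x, 0 ≤ ‖A x - B x‖ * (‖B x‖ + ‖A x - B x‖) ^ (p - 1) := fun x => by positivity
  have hJi : Integrable (fun x => ‖A x - B x‖ * (‖B x‖ + ‖A x - B x‖) ^ (p - 1)) μ := by
    refine (hSi.add (hzi.div_const 4)).mono' ((hAm.sub hBm).norm.mul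
      ((hBm.norm.add (hAm.sub hBm).norm).pow_const _)).aestronglyMeasurable (.of_forall fun x => ?_)
    rw [Real.norm_of_nonneg (hJ0 x)]
    simpa using mul_rpow_sub_one_le (norm_nonneg (B x)) (norm_nonneg (A x - B x)) one_pos
  have hS0 : 0 ≤ ∫ x, (‖B x‖ + ‖A x - B x‖) ^ (p - 2) * ‖A x - B x‖ ^ 2 ∂μ :=
    integral_nonneg fun x => by positivity
  have hBA : ∫ x, ‖B x‖ ^ p ∂μ ≤ ∫ x, ‖A x‖ ^ p ∂μ := by nlinarith
  refine ⟨hJi, hBA, fun t ht => ?_⟩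
  -- With `τ = t * κ` the second-order remainder becomes exactly `t` times what the deficit
  -- controls.
  have hτ : 0 < t * κ := by positivity
  have hJle := integral_mono hJi ((hSi.const_mul (t * κ)).add (hzi.div_const (4 * (t * κ))))
    fun x => mul_rpow_sub_one_le (norm_nonneg (B x)) (norm_nonneg (A x - B x)) hτ
  have hz := integral_mono hzi ((hAi.add hBi).const_mul (4 ^ p)) hzle
  simp only [Pi.add_apply] at hJle hz
  rw [integral_add (hSi.const_mul (t * κ)) (hzi.div_const (4 * (t * κ))), integral_const_mul,
    integral_div] at hJle
  rw [integral_const_mul, integral_add hAi hBi] at hz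
  have h1 : (∫ x, (‖B x‖ + ‖A x - B x‖) ^ p ∂μ) / (4 * (t * κ)) ≤
      4 ^ p / κ / t * ∫ x, ‖A x‖ ^ p ∂μ := by
    rw [div_le_iff₀ (by positivity)]
    have : 4 ^ p / κ / t * (∫ x, ‖A x‖ ^ p ∂μ) * (4 * (t * κ)) =
        4 ^ p * (4 * ∫ x, ‖A x‖ ^ p ∂μ) := by field_simp
    rw [this]
    refine hz.trans ?_
    have : 0 ≤ ∫ x, ‖A x‖ ^ p ∂μ := integral_nonneg fun x => by positivity
    gcongr
    linarith
  have h2 := mul_le_mul_of_nonneg_left hle ht.le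
  nlinarith

end HardyRemainder

/-! ### Localization near a level of the function. -/

section WeightedEstimate

set_option linter.unusedSectionVars false

open Module Filter Topology

/-- A weight localizing `σ` around the level `s`. -/
def levelWeight (s σ : ℝ) : ℝ := 2 * σ ^ 2 * s ^ 2 / (s ^ 2 + σ ^ 2) ^ 2

theorem levelWeight_nonneg (s σ : ℝ) : 0 ≤ levelWeight s σ := by
  unfold levelWeight; positivity

theorem levelWeight_le_one (s σ : ℝ) : levelWeight s σ ≤ 1 := by
  unfold levelWeight
  refine div_le_one_of_le₀ ?_ (by positivity)
  nlinarith [sq_nonneg (s ^ 2), sq_nonneg (σ ^ 2)]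

theorem continuous_levelWeight {s : ℝ} (hs : 0 < s) : Continuous (levelWeight s) := by
  unfold levelWeight
  exact Continuous.div (by fun_prop) (by fun_prop) fun σ => by positivity

/-- In the variable `s` the integrand has the primitive `-σ ^ 2 / (s ^ 2 + σ ^ 2)`. The bound is
uniform in `σ`, so summing the localized energies over all levels costs no more than the full
energy. -/
theorem lintegral_levelWeight_div_le (σ : ℝ) :
    ∫⁻ s in Ioi (0 : ℝ), ENNReal.ofReal (levelWeight s σ * s⁻¹) ≤ 1 := by
  rcases eq_or_ne σ 0 with rfl | hσ
  · simp [levelWeight]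
  have hden : ∀ s : ℝ, s ^ 2 + σ ^ 2 ≠ 0 := fun s => by positivity
  have hder : ∀ s ∈ Ioi (0 : ℝ), HasDerivAt (fun s => -(σ ^ 2 / (s ^ 2 + σ ^ 2)))
      (levelWeight s σ * s⁻¹) s := by
    intro s hs
    have hs : 0 < s := hs
    have h1 : HasDerivAt (fun s : ℝ => s ^ 2 + σ ^ 2) (2 * s) s := by
      simpa using (hasDerivAt_pow 2 s).add_const (σ ^ 2)
    have h2 := ((hasDerivAt_const s (σ ^ 2)).fun_div h1 (hden s)).fun_neg
    refine h2.congr_deriv ?_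
    unfold levelWeight
    field_simp
    ring
  have hcont : ContinuousWithinAt (fun s : ℝ => -(σ ^ 2 / (s ^ 2 + σ ^ 2))) (Ici 0) 0 :=
    (Continuous.neg (Continuous.div (by fun_prop) (by fun_prop) hden)).continuousWithinAt
  have hnn : ∀ s ∈ Ioi (0 : ℝ), 0 ≤ levelWeight s σ * s⁻¹ := fun s hs =>
    mul_nonneg (levelWeight_nonneg _ _) (inv_nonneg.2 (le_of_lt hs))
  have hlim : Tendsto (fun s : ℝ => -(σ ^ 2 / (s ^ 2 + σ ^ 2))) atTop (𝓝 0) := by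
    rw [← neg_zero]
    refine Tendsto.neg (Tendsto.const_div_atTop ?_ _)
    exact tendsto_atTop_add_const_right _ _ (tendsto_pow_atTop two_ne_zero)
  have hi := integrableOn_Ioi_deriv_of_nonneg hcont hder hnn hlim
  rw [← ofReal_integral_eq_lintegral_ofReal hi
    ((ae_restrict_mem measurableSet_Ioi).mono fun s hs => hnn s hs),
    integral_Ioi_of_hasDerivAt_of_nonneg hcont hder hnn hlim]
  have : (0 : ℝ) - -(σ ^ 2 / (0 ^ 2 + σ ^ 2)) = 1 := by field_simp; ring
  rw [this, ENNReal.ofReal_one]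

variable {E : Type*} [NormedAddCommGroup E] [InnerProductSpace ℝ E] [CompleteSpace E]
  [FiniteDimensional ℝ E] [MeasurableSpace E] [BorelSpace E] (μ : Measure E) [μ.IsAddHaarMeasure]

/-- The part of the Hardy potential near a level set of `f` is controlled by the first-order
remainder. -/
theorem integral_hardyField_levelWeight_le {p : ℝ} (hp : 1 < p) (hd : p < finrank ℝ E)
    {f : E → ℝ} (hf : ContDiff ℝ 1 f) (hfs : HasCompactSupport f) {c : ℝ}
    (hcdef : c = (finrank ℝ E - p) / p) {s : ℝ} (hs : 0 < s)
    (hJi : Integrable (fun x => ‖gradient f x - hardyField c f x‖ *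
        (‖hardyField c f x‖ + ‖gradient f x - hardyField c f x‖) ^ (p - 1)) μ) :
    ∫ x, ‖hardyField c f x‖ ^ p * levelWeight s (f x) ∂μ ≤
      (p + 1) * ∫ x, ‖gradient f x - hardyField c f x‖ *
        (‖hardyField c f x‖ + ‖gradient f x - hardyField c f x‖) ^ (p - 1) ∂μ := by
  have hp0 : 0 < p := by linarith
  have hc : 0 < c := by rw [hcdef]; exact div_pos (by linarith) hp0
  have hBi := integrable_norm_hardyField_rpow μ hc.le hp0 hd hf.continuous hfs
  have hden : ∀ σ : ℝ, s ^ 2 + σ ^ 2 ≠ 0 := fun σ => by positivity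
  -- For the test function `|σ| ^ p` alone, `σ * Θ' - p * Θ` is zero. The bounded factor `h` leaves
  -- `|σ| ^ p * (σ * h' σ)`, and `σ * h' σ` is the level weight.
  let h : ℝ → ℝ := fun σ => σ ^ 2 / (s ^ 2 + σ ^ 2)
  let h' : ℝ → ℝ := fun σ => 2 * σ * s ^ 2 / (s ^ 2 + σ ^ 2) ^ 2
  let Θ : ℝ → ℝ := fun σ => |σ| ^ p * h σ
  let Θ' : ℝ → ℝ := fun σ => p * |σ| ^ (p - 2) * σ * h σ + |σ| ^ p * h' σ
  have hh : ∀ σ, HasDerivAt h (h' σ) σ := by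
    intro σ
    have h1 : HasDerivAt (fun σ : ℝ => s ^ 2 + σ ^ 2) (2 * σ) σ := by
      simpa using (hasDerivAt_pow 2 σ).const_add (s ^ 2)
    have h2 : HasDerivAt (fun σ : ℝ => σ ^ 2) (2 * σ) σ := by simpa using hasDerivAt_pow 2 σ
    refine (h2.fun_div h1 (hden σ)).congr_deriv ?_
    simp only [h']
    congr 1; ring
  have hΘ : ∀ σ, HasDerivAt Θ (Θ' σ) σ := fun σ => (hasDerivAt_abs_rpow σ hp).fun_mul (hh σ)
  have hΘc : ContDiff ℝ 1 Θ := by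
    have h1 : ContDiff ℝ 1 fun σ : ℝ => |σ| ^ p := by
      simpa using contDiff_norm_rpow (E := ℝ) hp
    have h2 : ContDiff ℝ 1 h := ContDiff.div (by fun_prop) (by fun_prop) hden
    exact h1.mul h2
  have hΘ0 : Θ 0 = 0 := by simp [Θ, h]
  let Ψ : E → ℝ := fun x => Θ (f x)
  have hΨ : ContDiff ℝ 1 Ψ := hΘc.comp hf
  have hΨs : HasCompactSupport Ψ := hfs.comp_left (g := Θ) hΘ0
  have hDΨ : ∀ x, fderiv ℝ Ψ x x = Θ' (f x) * fderiv ℝ f x x := by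
    intro x
    have := ((hΘ (f x)).comp_hasFDerivAt x
      (hf.differentiable one_ne_zero x).hasFDerivAt).fderiv
    simp only [Function.comp_def] at this
    simp only [Ψ]
    rw [this]; simp
  set B := hardyField c f
  set A := gradient f
  have hDi : Integrable (fun x => ‖x‖ ^ (-p) * fderiv ℝ Ψ x x) μ := by
    refine integrable_norm_rpow_neg_mul μ hp0 hd
      ((hΨ.continuous_fderiv one_ne_zero).clm_apply continuous_id) ?_
    refine (hΨs.fderiv ℝ).mono ?_
    intro x hx h
    exact hx (by simp [h])
  have hΨi : Integrable (fun x => ‖x‖ ^ (-p) * Ψ x) μ :=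
    integrable_norm_rpow_neg_mul μ hp0 hd hΨ.continuous hΨs
  have hWi : Integrable (fun x => ‖B x‖ ^ p * levelWeight s (f x)) μ := by
    refine hBi.mono' (hBi.1.mul
      ((continuous_levelWeight hs).comp hf.continuous).aestronglyMeasurable) (.of_forall fun x => ?_)
    rw [Real.norm_of_nonneg (mul_nonneg (by positivity) (levelWeight_nonneg _ _))]
    exact mul_le_of_le_one_right (by positivity) (levelWeight_le_one _ _)
  have hΘalg : ∀ σ, σ * Θ' σ - p * Θ σ = |σ| ^ p * levelWeight s σ := by
    intro σ
    rcases eq_or_ne σ 0 with rfl | hσ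
    · simp [Θ, h, Real.zero_rpow hp0.ne']
    have e : |σ| ^ p = |σ| ^ (p - 2) * σ ^ 2 := by
      rw [← sq_abs, ← Real.rpow_natCast |σ| 2, ← Real.rpow_add (abs_pos.2 hσ)]
      push_cast; rw [sub_add_cancel]
    simp only [Θ, Θ', levelWeight, h', e]
    ring
  have hΘle : ∀ σ, |Θ' σ| ≤ (p + 1) * |σ| ^ (p - 1) := by
    intro σ
    rcases eq_or_ne σ 0 with rfl | hσ
    · simp [Θ', h']; positivity
    have ha : 0 < |σ| := abs_pos.2 hσ
    have e1 : |σ| ^ p = |σ| ^ (p - 1) * |σ| := by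
      rw [← Real.rpow_add_one ha.ne']; congr 1; ring
    have e2 : |σ| ^ (p - 1) = |σ| ^ (p - 2) * |σ| := by
      rw [← Real.rpow_add_one ha.ne']; congr 1; ring
    have hh1 : |h σ| ≤ 1 := by
      rw [abs_of_nonneg (by positivity)]
      exact div_le_one_of_le₀ (by nlinarith [sq_nonneg s]) (by positivity)
    have hh2 : |σ| * |h' σ| ≤ 1 := by
      have : |σ| * |h' σ| = levelWeight s σ := by
        rw [← abs_mul, ← abs_of_nonneg (levelWeight_nonneg s σ)]
        congr 1
        simp only [h', levelWeight]; ring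
      rw [this]; exact levelWeight_le_one _ _
    calc |Θ' σ| ≤ |p * |σ| ^ (p - 2) * σ * h σ| + |(|σ| ^ p * h' σ)| := abs_add_le _ _
      _ = p * |σ| ^ (p - 1) * |h σ| + |σ| ^ (p - 1) * (|σ| * |h' σ|) := by
          simp only [abs_mul, abs_of_pos hp0, Real.abs_rpow_of_nonneg (abs_nonneg σ), abs_abs]
          rw [e1, e2]; ring
      _ ≤ p * |σ| ^ (p - 1) * 1 + |σ| ^ (p - 1) * 1 := by gcongr
      _ = _ := by ring
  have hpt : ∀ x, ‖B x‖ ^ p * levelWeight s (f x) +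
      c ^ (p - 1) * (‖x‖ ^ (-p) * fderiv ℝ Ψ x x + p * c * (‖x‖ ^ (-p) * Ψ x)) ≤
      (p + 1) * (‖A x - B x‖ * (‖B x‖ + ‖A x - B x‖) ^ (p - 1)) := by
    intro x
    rcases eq_or_ne x 0 with rfl | hx
    -- The left side vanishes at the origin because `0 ^ (-p)` evaluates to `0`.
    · have hB0 : B 0 = 0 := by simp [B, hardyField]
      rw [hB0, norm_zero, Real.zero_rpow hp0.ne', Real.zero_rpow (neg_ne_zero.2 hp0.ne')]
      simp only [zero_mul, mul_zero, add_zero]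
      positivity
    have hr : 0 < ‖x‖ := norm_pos_iff.2 hx
    -- The radial derivative splits into that of a virtual extremal, `-c * f x`, and an error
    -- governed by `A - B`. The first part combines with `p * c * Ψ` into the level weight; the
    -- second is what `J` measures.
    have hD : fderiv ℝ f x x = inner ℝ (A x - B x) x - c * f x := by
      rw [inner_sub_left, inner_gradient_left]
      simp only [B, hardyField, inner_smul_left, real_inner_self_eq_norm_sq]
      simp only [conj_trivial]
      field_simp
      ring
    have e1 : c ^ p = c ^ (p - 1) * c := by
      rw [← Real.rpow_add_one hc.ne']; congr 1; ring
    have hbp := norm_hardyField_rpow (p := p) hc.le f x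
    have hb1 : ‖B x‖ ^ (p - 1) = c ^ (p - 1) * (‖x‖ ^ (-p) * ‖x‖) * |f x| ^ (p - 1) := by
      rw [norm_hardyField hc.le, Real.div_rpow (by positivity) hr.le,
        Real.mul_rpow hc.le (abs_nonneg _), ← Real.rpow_add_one hr.ne',
        show -p + 1 = -(p - 1) by ring, Real.rpow_neg hr.le]
      ring
    have e2 : ‖B x‖ ^ p * levelWeight s (f x) +
        c ^ (p - 1) * (‖x‖ ^ (-p) * fderiv ℝ Ψ x x + p * c * (‖x‖ ^ (-p) * Ψ x)) =
        c ^ (p - 1) * ‖x‖ ^ (-p) * (Θ' (f x) * inner ℝ (A x - B x) x) := by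
      rw [hbp, e1, hDΨ, hD]
      have := hΘalg (f x)
      simp only [Ψ]
      linear_combination (-(c ^ (p - 1) * c * ‖x‖ ^ (-p))) * this
    rw [e2]
    calc c ^ (p - 1) * ‖x‖ ^ (-p) * (Θ' (f x) * inner ℝ (A x - B x) x)
        ≤ c ^ (p - 1) * ‖x‖ ^ (-p) * (((p + 1) * |f x| ^ (p - 1)) * (‖A x - B x‖ * ‖x‖)) := by
          refine mul_le_mul_of_nonneg_left ((le_abs_self _).trans ?_) (by positivity)
          rw [abs_mul]
          exact mul_le_mul (hΘle _) (abs_real_inner_le_norm _ _) (abs_nonneg _) (by positivity)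
      _ = (p + 1) * (‖A x - B x‖ * ‖B x‖ ^ (p - 1)) := by rw [hb1]; ring
      _ ≤ _ := by
          gcongr
          linarith [norm_nonneg (A x - B x)]
  have hint := integral_mono (hWi.add ((hDi.add (hΨi.const_mul (p * c))).const_mul (c ^ (p - 1))))
    (hJi.const_mul (p + 1)) hpt
  simp only [Pi.add_apply] at hint
  rw [integral_add hWi (g := fun x => c ^ (p - 1) *
      (‖x‖ ^ (-p) * fderiv ℝ Ψ x x + p * c * (‖x‖ ^ (-p) * Ψ x)))
      ((hDi.add (hΨi.const_mul (p * c))).const_mul (c ^ (p - 1))),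
    integral_const_mul, integral_const_mul, integral_add hDi (hΨi.const_mul (p * c)), integral_const_mul,
    integral_norm_rpow_neg_mul_fderiv μ hp0 hd hΨ hΨs] at hint
  have : (finrank ℝ E : ℝ) - p = p * c := by rw [hcdef]; field_simp
  rw [this] at hint
  linarith

/-- Chebyshev and Sobolev applied to a smooth truncation of `f` that exceeds `s / 2` where `|f| > s`
and whose derivative is small away from the level `s`. -/
theorem rpow_mul_distribution_le_levelWeight {p q : ℝ} (hp : 1 < p) (hd : p < finrank ℝ E)
    (hq : 0 < q) (hpq : q⁻¹ = p⁻¹ - (finrank ℝ E : ℝ)⁻¹) :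
    ∃ K : ℝ, 0 < K ∧ ∀ f : E → ℝ, ContDiff ℝ 1 f → HasCompactSupport f → ∀ s : ℝ, 0 < s →
      ENNReal.ofReal (s ^ p) * μ {x | s < |f x|} ^ (p / q) ≤
        ENNReal.ofReal K * ∫⁻ x, ENNReal.ofReal (levelWeight s (f x) * ‖gradient f x‖ ^ p) ∂μ := by
  have hp0 : 0 < p := by linarith
  set K₀ : NNReal := eLpNormLESNormFDerivOfEqInnerConst μ p.toNNReal
  refine ⟨2 ^ p * ((K₀ + 1) ^ p * 4 ^ p), by positivity, fun f hf hfs s hs => ?_⟩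
  have hden : ∀ σ : ℝ, s ^ 4 + σ ^ 4 ≠ 0 := fun σ => by positivity
  -- Fourth powers make `|Φ'|` itself at most four times the level weight, so its `p`-th power is
  -- controlled for all `p > 1`. Squares would give only order `σ / s` near zero, which fails for `p
  -- < 2`.
  let Φ : ℝ → ℝ := fun σ => s * σ ^ 4 / (s ^ 4 + σ ^ 4)
  let Φ' : ℝ → ℝ := fun σ => 4 * s ^ 5 * σ ^ 3 / (s ^ 4 + σ ^ 4) ^ 2
  have hΦ : ∀ σ, HasDerivAt Φ (Φ' σ) σ := by
    intro σ
    have h1 : HasDerivAt (fun σ : ℝ => s ^ 4 + σ ^ 4) (4 * σ ^ 3) σ := by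
      simpa using (hasDerivAt_pow 4 σ).const_add (s ^ 4)
    have h2 : HasDerivAt (fun σ : ℝ => s * σ ^ 4) (s * (4 * σ ^ 3)) σ := by
      simpa using (hasDerivAt_pow 4 σ).const_mul s
    refine (h2.fun_div h1 (hden σ)).congr_deriv ?_
    simp only [Φ']
    congr 1; ring
  have hΦc : ContDiff ℝ 1 Φ := ContDiff.div (by fun_prop) (by fun_prop) hden
  have hΦle : ∀ σ, |Φ' σ| ^ p ≤ 4 ^ p * levelWeight s σ := by
    intro σ
    have h1 : |Φ' σ| ≤ 4 * levelWeight s σ := by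
      simp only [Φ', levelWeight]
      rw [abs_div, abs_of_pos (by positivity : 0 < (s ^ 4 + σ ^ 4) ^ 2), abs_mul, abs_pow,
        abs_of_pos (by positivity : 0 < 4 * s ^ 5), mul_div_assoc', div_le_div_iff₀ (by positivity)
        (by positivity), show σ ^ 2 = |σ| ^ 2 by simp, show σ ^ 4 = |σ| ^ 4 by
          rw [← abs_pow, abs_of_nonneg (by positivity)]]
      set a := |σ|
      have ha : 0 ≤ a := abs_nonneg σ
      have k1 : (s ^ 2 + a ^ 2) ^ 2 ≤ 2 * (s ^ 4 + a ^ 4) := by nlinarith [sq_nonneg (s ^ 2 - a ^ 2)]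
      have k2 : s ^ 3 * a ≤ s ^ 4 + a ^ 4 := by
        rcases le_total a s with h | h
        · have : s ^ 3 * a ≤ s ^ 3 * s := by gcongr
          nlinarith [pow_nonneg ha 4]
        · have : s ^ 3 * a ≤ a ^ 3 * a := by gcongr
          nlinarith [pow_pos hs 4]
      calc 4 * s ^ 5 * a ^ 3 * (s ^ 2 + a ^ 2) ^ 2
          = 4 * s ^ 2 * a ^ 2 * ((s ^ 3 * a) * (s ^ 2 + a ^ 2) ^ 2) := by ring
        _ ≤ 4 * s ^ 2 * a ^ 2 * ((s ^ 4 + a ^ 4) * (2 * (s ^ 4 + a ^ 4))) := by gcongr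
        _ = _ := by ring
    calc |Φ' σ| ^ p ≤ (4 * levelWeight s σ) ^ p := by gcongr
      _ = 4 ^ p * levelWeight s σ ^ p := Real.mul_rpow (by norm_num) (levelWeight_nonneg _ _)
      _ ≤ 4 ^ p * levelWeight s σ := by
          gcongr
          exact Real.rpow_le_self_of_le_one (levelWeight_nonneg _ _) (levelWeight_le_one _ _) hp.le
  have hgc : ContDiff ℝ 1 (Φ ∘ f) := hΦc.comp hf
  have hgs : HasCompactSupport (Φ ∘ f) := hfs.comp_left (by simp [Φ])
  have hD : ∀ x, ‖fderiv ℝ (Φ ∘ f) x‖ₑ ^ p ≤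
      ENNReal.ofReal (4 ^ p) * ENNReal.ofReal (levelWeight s (f x) * ‖gradient f x‖ ^ p) := by
    intro x
    rw [((hΦ (f x)).comp_hasFDerivAt x (hf.differentiable one_ne_zero x).hasFDerivAt).fderiv,
      ← ofReal_norm, ENNReal.ofReal_rpow_of_nonneg (norm_nonneg _) hp0.le, norm_smul,
      Real.mul_rpow (norm_nonneg _) (norm_nonneg _), ← ENNReal.ofReal_mul (by positivity),
      norm_gradient, Real.norm_eq_abs, ← mul_assoc]
    gcongr
    exact hΦle _
  have hgns := eLpNorm_le_eLpNorm_fderiv_of_eq_inner μ hgc hgs (p := p.toNNReal)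
    (p' := q.toNNReal) (by simpa using hp.le)
    (by have : (0 : ℝ) < finrank ℝ E := hp0.trans hd
        exact_mod_cast this)
    (by rw [NNReal.coe_inv, Real.coe_toNNReal _ hq.le, Real.coe_toNNReal _ hp0.le, hpq])
  have hqne : (q.toNNReal : ℝ≥0∞) ≠ 0 := by simpa using hq
  have hcheb := mul_meas_ge_le_pow_eLpNorm' μ hqne ENNReal.coe_ne_top
    hgc.continuous.aestronglyMeasurable (ENNReal.ofReal (s / 2))
  have hqR : (q.toNNReal : ℝ≥0∞).toReal = q := by simp [hq.le]
  have hpR : (p.toNNReal : ℝ≥0∞).toReal = p := by simp [hp0.le]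
  rw [hqR] at hcheb
  have hsub : μ {x | s < |f x|} ≤ μ {x | ENNReal.ofReal (s / 2) ≤ ‖(Φ ∘ f) x‖ₑ} := by
    refine measure_mono fun x hx => ?_
    have hx : s < |f x| := hx
    simp only [mem_ofPred_eq, Function.comp_apply]
    rw [← ofReal_norm]
    refine ENNReal.ofReal_le_ofReal ?_
    have hpow : s ^ 4 ≤ f x ^ 4 := by
      have : s ^ 4 ≤ |f x| ^ 4 := by gcongr
      rwa [← abs_pow, abs_of_nonneg (by positivity)] at this
    simp only [Φ]
    rw [Real.norm_of_nonneg (by positivity), div_le_div_iff₀ (by norm_num) (by positivity)]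
    nlinarith
  have hmain : ENNReal.ofReal (s / 2) ^ p * μ {x | s < |f x|} ^ (p / q) ≤
      eLpNorm (Φ ∘ f) q.toNNReal μ ^ p := by
    have h1 := ENNReal.rpow_le_rpow ((mul_le_mul_right hsub _).trans hcheb)
      (by positivity : 0 ≤ p / q)
    rw [ENNReal.mul_rpow_of_nonneg _ _ (by positivity), ← ENNReal.rpow_mul, ← ENNReal.rpow_mul,
      mul_div_cancel₀ _ hq.ne'] at h1
    exact h1
  have hpne : (p.toNNReal : ℝ≥0∞) ≠ 0 := by simpa using hp0
  have hnorm : eLpNorm (fderiv ℝ (Φ ∘ f)) p.toNNReal μ ^ p =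
      ∫⁻ x, ‖fderiv ℝ (Φ ∘ f) x‖ₑ ^ p ∂μ := by
    rw [eLpNorm_eq_lintegral_rpow_enorm_toReal hpne ENNReal.coe_ne_top, hpR, ← ENNReal.rpow_mul,
      one_div_mul_cancel hp0.ne', ENNReal.rpow_one]
  have hs2 : ENNReal.ofReal (s ^ p) = ENNReal.ofReal (2 ^ p) * ENNReal.ofReal (s / 2) ^ p := by
    rw [ENNReal.ofReal_rpow_of_pos (by positivity), ← ENNReal.ofReal_mul (by positivity),
      ← Real.mul_rpow (by norm_num) (by positivity)]
    congr 2; ring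
  have hK : (K₀ : ℝ≥0∞) ^ p ≤ ENNReal.ofReal ((K₀ + 1) ^ p) := by
    rw [← ENNReal.ofReal_rpow_of_nonneg (by positivity) hp0.le]
    gcongr
    rw [← ENNReal.ofReal_coe_nnreal]
    exact ENNReal.ofReal_le_ofReal (by linarith)
  calc ENNReal.ofReal (s ^ p) * μ {x | s < |f x|} ^ (p / q)
      = ENNReal.ofReal (2 ^ p) * (ENNReal.ofReal (s / 2) ^ p * μ {x | s < |f x|} ^ (p / q)) := by
        rw [hs2, mul_assoc]
    _ ≤ ENNReal.ofReal (2 ^ p) * ((K₀ * eLpNorm (fderiv ℝ (Φ ∘ f)) p.toNNReal μ) ^ p) := by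
        gcongr
        exact hmain.trans (ENNReal.rpow_le_rpow hgns hp0.le)
    _ = ENNReal.ofReal (2 ^ p) * ((K₀ : ℝ≥0∞) ^ p * ∫⁻ x, ‖fderiv ℝ (Φ ∘ f) x‖ₑ ^ p ∂μ) := by
        rw [ENNReal.mul_rpow_of_nonneg _ _ hp0.le, hnorm]
    _ ≤ ENNReal.ofReal (2 ^ p) * (ENNReal.ofReal ((K₀ + 1) ^ p) * ∫⁻ x, ENNReal.ofReal (4 ^ p) *
          ENNReal.ofReal (levelWeight s (f x) * ‖gradient f x‖ ^ p) ∂μ) := by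
        gcongr with x
        exact hD x
    _ = _ := by
        rw [lintegral_const_mul' _ _ ENNReal.ofReal_ne_top, ENNReal.ofReal_mul (by positivity),
          ENNReal.ofReal_mul (by positivity)]
        ring

end WeightedEstimate

/-! ### A package of inequalities stable under almost everywhere limits. -/

section EnergyBounds

set_option linter.unusedSectionVars false

open Module Filter Topology

theorem ENNReal.liminf_add_liminf_le (a b : ℕ → ℝ≥0∞) :
    liminf a atTop + liminf b atTop ≤ liminf (fun n => a n + b n) atTop := by
  simp only [liminf_eq_iSup_iInf_of_nat]
  rw [ENNReal.iSup_add_iSup_of_monotone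
    (fun i j hij => biInf_mono fun k hk => le_trans hij hk)
    (fun i j hij => biInf_mono fun k hk => le_trans hij hk)]
  refine iSup_mono fun i => le_iInf₂ fun k hk => ?_
  exact add_le_add (iInf₂_le k hk) (iInf₂_le k hk)

theorem ENNReal.mul_liminf_rpow {a r : ℝ} (hr : 0 ≤ r) (m : ℕ → ℝ≥0∞) :
    ENNReal.ofReal a * (liminf m atTop) ^ r = liminf (fun n => ENNReal.ofReal a * m n ^ r) atTop := by
  have hmono : Monotone fun x : ℝ≥0∞ => ENNReal.ofReal a * x ^ r := fun x y h =>
    mul_le_mul_right (ENNReal.rpow_le_rpow h hr) _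
  exact hmono.map_liminf_of_continuousAt m
    ((ENNReal.continuous_const_mul ENNReal.ofReal_ne_top).comp
      (ENNReal.continuous_rpow_const (y := r))).continuousAt

variable {E : Type*} [NormedAddCommGroup E] [MeasurableSpace E]

/-- Bounds on a function `u` in terms of an energy `g`: Hardy inequality, Lorentz-Sobolev
inequality, and control of the superlevel sets by the geometric mean of the Hardy deficit and
the energy (in linearized form). -/
structure EnergyBounds (μ : Measure E) (p q c C : ℝ) (u : E → ℝ) (g : ℝ≥0∞) : Prop where
  hardy : ENNReal.ofReal (c ^ p) * ∫⁻ x, ENNReal.ofReal (|u x| ^ p / ‖x‖ ^ p) ∂μ ≤ g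
  lorentz : ∫⁻ s in Ioi (0 : ℝ), ENNReal.ofReal (s ^ (p - 1)) * μ {x | s < |u x|} ^ (p / q) ≤
    ENNReal.ofReal C * g
  weak : ∀ s : ℝ, 0 < s → ∀ t : ℝ, 0 < t → ENNReal.ofReal (s ^ p) * μ {x | s < |u x|} ^ (p / q) +
    ENNReal.ofReal (t * c ^ p) * ∫⁻ x, ENNReal.ofReal (|u x| ^ p / ‖x‖ ^ p) ∂μ ≤
      ENNReal.ofReal (t + C / t) * g

/-- Fatou for indicators: the strict inequality `s < |u x|` is an open condition, so it passes to `v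
n x` for all large `n`. -/
theorem measure_superlevel_le_liminf {μ : Measure E} {u : E → ℝ} {v : ℕ → E → ℝ}
    (hv : ∀ n, AEMeasurable (v n) μ) (hlim : ∀ᵐ x ∂μ, Tendsto (fun n => v n x) atTop (𝓝 (u x)))
    (s : ℝ) : μ {x | s < |u x|} ≤ liminf (fun n => μ {x | s < |v n x|}) atTop := by
  have hu : AEMeasurable u μ := aemeasurable_of_tendsto_metrizable_ae atTop hv hlim
  have hnm : ∀ w : E → ℝ, AEMeasurable w μ → NullMeasurableSet {x | s < |w x|} μ := fun w hw =>
    nullMeasurableSet_lt aemeasurable_const hw.abs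
  simp_rw [← fun n => lintegral_indicator_one₀ (hnm (v n) (hv n)),
    ← lintegral_indicator_one₀ (hnm u hu)]
  refine le_trans (lintegral_mono_ae ?_) (lintegral_liminf_le' fun n =>
    (aemeasurable_indicator_const_iff (1 : ℝ≥0∞)).2 (hnm (v n) (hv n)))
  filter_upwards [hlim] with x hx
  by_cases h : s < |u x|
  · have : ∀ᶠ n in atTop, s < |v n x| := hx.abs.eventually (lt_mem_nhds h)
    refine le_liminf_of_le (by isBoundedDefault) ?_
    filter_upwards [this] with n hn
    rw [indicator_of_mem (by exact h), indicator_of_mem (by exact hn)]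
  · rw [indicator_of_notMem (by exact h)]
    exact zero_le

theorem lintegral_hardy_le_liminf [BorelSpace E] {μ : Measure E} {p : ℝ} (hp : 0 < p)
    {u : E → ℝ} {v : ℕ → E → ℝ} (hv : ∀ n, AEMeasurable (v n) μ)
    (hlim : ∀ᵐ x ∂μ, Tendsto (fun n => v n x) atTop (𝓝 (u x))) :
    ∫⁻ x, ENNReal.ofReal (|u x| ^ p / ‖x‖ ^ p) ∂μ ≤
      liminf (fun n => ∫⁻ x, ENNReal.ofReal (|v n x| ^ p / ‖x‖ ^ p) ∂μ) atTop := by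
  refine le_trans (lintegral_mono_ae ?_) (lintegral_liminf_le' fun n => ?_)
  · filter_upwards [hlim] with x hx
    refine (Tendsto.liminf_eq ?_).ge
    exact ENNReal.tendsto_ofReal ((hx.abs.rpow_const (Or.inr hp.le)).div_const _)
  · exact (((hv n).abs.pow_const p).div (measurable_norm.pow_const p).aemeasurable).ennreal_ofReal

/-- Energy bounds are stable under almost everywhere convergence. -/
theorem EnergyBounds.of_tendsto [BorelSpace E] {μ : Measure E} {p q c C : ℝ} (hp : 0 < p)
    (hq : 0 < q) {u : E → ℝ} {v : ℕ → E → ℝ} {g : ℝ≥0∞} {h : ℕ → ℝ≥0∞}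
    (hv : ∀ n, AEMeasurable (v n) μ)
    (hlim : ∀ᵐ x ∂μ, Tendsto (fun n => v n x) atTop (𝓝 (u x))) (hh : Tendsto h atTop (𝓝 g))
    (hb : ∀ n, EnergyBounds μ p q c C (v n) (h n)) : EnergyBounds μ p q c C u g := by
  have hr : 0 ≤ p / q := by positivity
  have hH := lintegral_hardy_le_liminf (μ := μ) hp hv hlim
  have hμ := measure_superlevel_le_liminf (μ := μ) hv hlim
  have hcH : ∀ a : ℝ, ENNReal.ofReal a * ∫⁻ x, ENNReal.ofReal (|u x| ^ p / ‖x‖ ^ p) ∂μ ≤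
      liminf (fun n => ENNReal.ofReal a * ∫⁻ x, ENNReal.ofReal (|v n x| ^ p / ‖x‖ ^ p) ∂μ)
        atTop := by
    intro a
    have := ENNReal.mul_liminf_rpow (a := a) zero_le_one
      (fun n => ∫⁻ x, ENNReal.ofReal (|v n x| ^ p / ‖x‖ ^ p) ∂μ)
    simp only [ENNReal.rpow_one] at this
    rw [← this]
    gcongr
  have hcμ : ∀ a s : ℝ, ENNReal.ofReal a * μ {x | s < |u x|} ^ (p / q) ≤
      liminf (fun n => ENNReal.ofReal a * μ {x | s < |v n x|} ^ (p / q)) atTop := by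
    intro a s
    rw [← ENNReal.mul_liminf_rpow hr]
    gcongr
    exact hμ s
  have hR : ∀ a : ℝ, liminf (fun n => ENNReal.ofReal a * h n) atTop = ENNReal.ofReal a * g :=
    fun a => (ENNReal.Tendsto.const_mul hh (Or.inr ENNReal.ofReal_ne_top)).liminf_eq
  refine ⟨?_, ?_, fun s hs t ht => ?_⟩
  · calc _ ≤ _ := hcH _
      _ ≤ liminf h atTop := liminf_le_liminf (.of_forall fun n => (hb n).hardy)
      _ = g := hh.liminf_eq
  · calc _ ≤ ∫⁻ s in Ioi (0 : ℝ),
          liminf (fun n => ENNReal.ofReal (s ^ (p - 1)) * μ {x | s < |v n x|} ^ (p / q)) atTop :=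
          lintegral_mono fun s => hcμ _ s
      _ ≤ liminf (fun n => ∫⁻ s in Ioi (0 : ℝ),
          ENNReal.ofReal (s ^ (p - 1)) * μ {x | s < |v n x|} ^ (p / q)) atTop := by
          refine lintegral_liminf_le' fun n => Measurable.aemeasurable ?_
          have : Antitone fun s : ℝ => μ {x | s < |v n x|} := fun a b hab =>
            measure_mono fun x hx => lt_of_le_of_lt hab hx
          exact (measurable_id.pow_const _).ennreal_ofReal.mul (this.measurable.pow_const _)
      _ ≤ liminf (fun n => ENNReal.ofReal C * h n) atTop :=
          liminf_le_liminf (.of_forall fun n => (hb n).lorentz)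
      _ = _ := hR C
  · calc _ ≤ _ := (add_le_add (hcμ _ _) (hcH _)).trans (ENNReal.liminf_add_liminf_le _ _)
      _ ≤ liminf (fun n => ENNReal.ofReal (t + C / t) * h n) atTop :=
          liminf_le_liminf (.of_forall fun n => (hb n).weak s hs t ht)
      _ = _ := hR _

theorem EnergyBounds.mono {μ : Measure E} {p q c C : ℝ} {u : E → ℝ} {g g' : ℝ≥0∞}
    (h : EnergyBounds μ p q c C u g) (hg : g ≤ g') : EnergyBounds μ p q c C u g' :=
  ⟨h.hardy.trans hg, h.lorentz.trans (mul_le_mul_right hg _),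
    fun s hs t ht => (h.weak s hs t ht).trans (mul_le_mul_right hg _)⟩

end EnergyBounds

/-! ### The three energy bounds for compactly supported `C¹` functions. -/

section TestFunctions

set_option linter.unusedSectionVars false

open Module Filter Topology

variable {E : Type*} [NormedAddCommGroup E] [InnerProductSpace ℝ E] [CompleteSpace E]
  [FiniteDimensional ℝ E] [MeasurableSpace E] [BorelSpace E] (μ : Measure E) [μ.IsAddHaarMeasure]

theorem exists_energyBounds_of_contDiff {p q : ℝ} (hp : 1 < p) (hd : p < finrank ℝ E)
    (hq : 0 < q) (hpq : q⁻¹ = p⁻¹ - (finrank ℝ E : ℝ)⁻¹) {c : ℝ}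
    (hcdef : c = (finrank ℝ E - p) / p) :
    ∃ C : ℝ, 0 < C ∧ ∀ f : E → ℝ, ContDiff ℝ 1 f → HasCompactSupport f →
      EnergyBounds μ p q c C f (∫⁻ x, ‖fderiv ℝ f x‖ₑ ^ p ∂μ) := by
  have hp0 : 0 < p := by linarith
  have hc : 0 < c := by rw [hcdef]; exact div_pos (by linarith) hp0
  obtain ⟨K, hK, hsob⟩ := rpow_mul_distribution_le_levelWeight μ hp hd hq hpq
  obtain ⟨C₁, hC₁, hrem⟩ := exists_first_order_remainder μ hp hd
  set L : ℝ := K * (2 ^ p * (p + 2)) with hL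
  have hL0 : 0 < L := by positivity
  refine ⟨max K (L ^ 2 * C₁), lt_max_of_lt_left hK, fun f hf hfs => ?_⟩
  obtain ⟨hJi, hBA, hJ⟩ := hrem f hf hfs c hcdef
  have hAi := integrable_norm_gradient_rpow μ hp0 hf hfs
  have hBi := integrable_norm_hardyField_rpow μ hc.le hp0 hd hf.continuous hfs
  have hg : ∫⁻ x, ‖fderiv ℝ f x‖ₑ ^ p ∂μ = ENNReal.ofReal (∫ x, ‖gradient f x‖ ^ p ∂μ) := by
    rw [ofReal_integral_eq_lintegral_ofReal hAi (.of_forall fun x => by positivity)]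
    refine lintegral_congr fun x => ?_
    rw [norm_gradient, ← ofReal_norm, ENNReal.ofReal_rpow_of_nonneg (norm_nonneg _) hp0.le]
  have hBH : ENNReal.ofReal (∫ x, ‖hardyField c f x‖ ^ p ∂μ) =
      ENNReal.ofReal (c ^ p) * ∫⁻ x, ENNReal.ofReal (|f x| ^ p / ‖x‖ ^ p) ∂μ := by
    rw [ofReal_integral_eq_lintegral_ofReal hBi (.of_forall fun x => by positivity),
      ← lintegral_const_mul' _ _ ENNReal.ofReal_ne_top]
    refine lintegral_congr fun x => ?_
    rw [← ENNReal.ofReal_mul (by positivity), norm_hardyField_rpow hc.le,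
      Real.rpow_neg (norm_nonneg _)]
    congr 2; ring
  have hG0 : 0 ≤ ∫ x, ‖gradient f x‖ ^ p ∂μ := integral_nonneg fun x => by positivity
  have hB0 : 0 ≤ ∫ x, ‖hardyField c f x‖ ^ p ∂μ := integral_nonneg fun x => by positivity
  set J := ∫ x, ‖gradient f x - hardyField c f x‖ *
    (‖hardyField c f x‖ + ‖gradient f x - hardyField c f x‖) ^ (p - 1) ∂μ with hJdef
  have hJ0 : 0 ≤ J := integral_nonneg fun x => by positivity
  have hweak : ∀ s : ℝ, 0 < s →
      ENNReal.ofReal (s ^ p) * μ {x | s < |f x|} ^ (p / q) ≤ ENNReal.ofReal (L * J) := by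
    intro s hs
    have hWi : Integrable (fun x => ‖hardyField c f x‖ ^ p * levelWeight s (f x)) μ := by
      refine hBi.mono' (hBi.1.mul
        ((continuous_levelWeight hs).comp hf.continuous).aestronglyMeasurable)
        (.of_forall fun x => ?_)
      rw [Real.norm_of_nonneg (mul_nonneg (by positivity) (levelWeight_nonneg _ _))]
      exact mul_le_of_le_one_right (by positivity) (levelWeight_le_one _ _)
    have hpt : ∀ x, levelWeight s (f x) * ‖gradient f x‖ ^ p ≤
        2 ^ p * (‖hardyField c f x‖ ^ p * levelWeight s (f x) +
          ‖gradient f x - hardyField c f x‖ *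
            (‖hardyField c f x‖ + ‖gradient f x - hardyField c f x‖) ^ (p - 1)) := by
      intro x
      set a := ‖gradient f x‖
      set b := ‖hardyField c f x‖
      set y := ‖gradient f x - hardyField c f x‖
      have hy0 : 0 ≤ y := norm_nonneg _
      have hb0 : 0 ≤ b := norm_nonneg _
      have h1 : a ≤ b + y := by
        have := norm_add_le (hardyField c f x) (gradient f x - hardyField c f x)
        rwa [add_sub_cancel] at this
      have h2 : a ^ p ≤ 2 ^ p * (b ^ p + y ^ p) :=
        (Real.rpow_le_rpow (norm_nonneg _) h1 hp0.le).trans (add_rpow_le_two_rpow hp0.le hb0 hy0)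
      -- The part of the gradient not explained by the Hardy field needs no localization, since `J`
      -- bounds its full `L^p` energy.
      have h3 : y ^ p ≤ y * (b + y) ^ (p - 1) := by
        have : y ^ p = y * y ^ (p - 1) := by
          rcases hy0.eq_or_lt with h | h
          · rw [← h, Real.zero_rpow hp0.ne', zero_mul]
          · rw [mul_comm, ← Real.rpow_add_one h.ne', sub_add_cancel]
        rw [this]; gcongr; linarith
      have hw0 := levelWeight_nonneg s (f x)
      have hw1 := levelWeight_le_one s (f x)
      have h4 : levelWeight s (f x) * y ^ p ≤ y * (b + y) ^ (p - 1) :=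
        (mul_le_of_le_one_left (by positivity) hw1).trans h3
      calc levelWeight s (f x) * a ^ p ≤ levelWeight s (f x) * (2 ^ p * (b ^ p + y ^ p)) := by
            gcongr
        _ = 2 ^ p * (b ^ p * levelWeight s (f x) + levelWeight s (f x) * y ^ p) := by ring
        _ ≤ _ := by gcongr
    have hi : Integrable (fun x => 2 ^ p * (‖hardyField c f x‖ ^ p * levelWeight s (f x) +
          ‖gradient f x - hardyField c f x‖ *
            (‖hardyField c f x‖ + ‖gradient f x - hardyField c f x‖) ^ (p - 1))) μ :=
      (hWi.add hJi).const_mul _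
    have h5 := integral_hardyField_levelWeight_le μ hp hd hf hfs hcdef hs hJi
    calc _ ≤ _ := hsob f hf hfs s hs
      _ ≤ ENNReal.ofReal K * ∫⁻ x, ENNReal.ofReal (2 ^ p * (‖hardyField c f x‖ ^ p *
          levelWeight s (f x) + ‖gradient f x - hardyField c f x‖ *
            (‖hardyField c f x‖ + ‖gradient f x - hardyField c f x‖) ^ (p - 1))) ∂μ := by
          exact mul_le_mul_right (lintegral_mono fun x => ENNReal.ofReal_le_ofReal (hpt x)) _
      _ ≤ _ := by
          rw [← ofReal_integral_eq_lintegral_ofReal hi (.of_forall fun x => by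
              have := levelWeight_nonneg s (f x)
              positivity),
            ← ENNReal.ofReal_mul hK.le, integral_const_mul, integral_add hWi hJi]
          refine ENNReal.ofReal_le_ofReal ?_
          rw [hL, mul_assoc, mul_assoc]
          gcongr
          linarith
  refine ⟨?_, ?_, fun s hs t ht => ?_⟩
  · rw [← hBH, hg]
    exact ENNReal.ofReal_le_ofReal hBA
  · have hmeas : Measurable (Function.uncurry fun (s : ℝ) (x : E) =>
        ENNReal.ofReal (levelWeight s (f x) * s⁻¹) * ENNReal.ofReal (‖gradient f x‖ ^ p)) := by
      unfold levelWeight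
      have := hf.continuous.measurable
      have h2 := (continuous_gradient hf).measurable
      simp only [Function.uncurry_def]
      fun_prop
    calc _ ≤ ∫⁻ s in Ioi (0 : ℝ), ENNReal.ofReal K * ∫⁻ x,
          ENNReal.ofReal (levelWeight s (f x) * s⁻¹) * ENNReal.ofReal (‖gradient f x‖ ^ p) ∂μ := by
          refine setLIntegral_mono' measurableSet_Ioi fun s hs => ?_
          have hs : 0 < s := hs
          have h1 := mul_le_mul_right (hsob f hf hfs s hs) (ENNReal.ofReal s⁻¹)
          rw [← mul_assoc, ← ENNReal.ofReal_mul (by positivity), mul_left_comm,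
            ← lintegral_const_mul' _ _ ENNReal.ofReal_ne_top] at h1
          have e1 : s⁻¹ * s ^ p = s ^ (p - 1) := by rw [Real.rpow_sub_one hs.ne']; field_simp
          rw [e1] at h1
          refine h1.trans (le_of_eq ?_)
          congr 1
          refine lintegral_congr fun x => ?_
          have := levelWeight_nonneg s (f x)
          rw [← ENNReal.ofReal_mul (by positivity), ← ENNReal.ofReal_mul (by positivity)]
          congr 1; ring
      -- Tonelli: for fixed `x` the weights integrate in `ds/s` to at most 1.
      _ = ENNReal.ofReal K * ∫⁻ x, (∫⁻ s in Ioi (0 : ℝ),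
          ENNReal.ofReal (levelWeight s (f x) * s⁻¹)) * ENNReal.ofReal (‖gradient f x‖ ^ p) ∂μ := by
          rw [lintegral_const_mul' _ _ ENNReal.ofReal_ne_top,
            lintegral_lintegral_swap hmeas.aemeasurable]
          congr 1
          exact lintegral_congr fun x => lintegral_mul_const' _ _ ENNReal.ofReal_ne_top
      _ ≤ ENNReal.ofReal K * ∫⁻ x, ENNReal.ofReal (‖gradient f x‖ ^ p) ∂μ := by
          gcongr with x
          exact mul_le_of_le_one_left zero_le (lintegral_levelWeight_div_le _)
      _ ≤ _ := by
          rw [hg, ofReal_integral_eq_lintegral_ofReal hAi (.of_forall fun x => by positivity)]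
          gcongr
          exact le_max_left _ _
  · rw [hg, ENNReal.ofReal_mul ht.le, mul_assoc, ← hBH, ← ENNReal.ofReal_mul ht.le,
      ← ENNReal.ofReal_mul (by positivity)]
    refine (add_le_add_left (hweak s hs) _).trans ?_
    rw [← ENNReal.ofReal_add (by positivity) (by positivity)]
    refine ENNReal.ofReal_le_ofReal ?_
    -- The parameter is rescaled so that, after multiplication by `L`, the Hardy term has
    -- coefficient exactly `t`. This is the origin of `L ^ 2 * C₁`.
    have h1 := mul_le_mul_of_nonneg_left (hJ (t / L) (by positivity)) hL0.le
    have h2 : L * (J + t / L * ∫ x, ‖hardyField c f x‖ ^ p ∂μ) =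
        L * J + t * ∫ x, ‖hardyField c f x‖ ^ p ∂μ := by field_simp
    have h3 : L * ((t / L + C₁ / (t / L)) * ∫ x, ‖gradient f x‖ ^ p ∂μ) =
        (t + L ^ 2 * C₁ / t) * ∫ x, ‖gradient f x‖ ^ p ∂μ := by field_simp
    rw [h2, h3] at h1
    refine h1.trans ?_
    gcongr
    exact le_max_right _ _

end TestFunctions

/-! ### Mollification does not increase the gradient energy. -/

section Mollification

open Module Filter Topology

/-- Mollification of `u` by a bump function. -/
def mollify {N : ℕ} (φ : ContDiffBump (0 : EuclideanSpace ℝ (Fin N)))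
    (u : EuclideanSpace ℝ (Fin N) → ℝ) : EuclideanSpace ℝ (Fin N) → ℝ :=
  convolution (φ.normed volume) u (ContinuousLinearMap.lsmul ℝ ℝ) volume

variable {N : ℕ} {u : EuclideanSpace ℝ (Fin N) → ℝ}
  {G : EuclideanSpace ℝ (Fin N) → EuclideanSpace ℝ (Fin N)}

theorem contDiff_mollify (φ : ContDiffBump (0 : EuclideanSpace ℝ (Fin N)))
    (hu : LocallyIntegrable u volume) : ContDiff ℝ 1 (mollify φ u) :=
  φ.hasCompactSupport_normed.contDiff_convolution_left (n := 1) _ φ.contDiff_normed hu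

/-- The gradient of the mollification is the mollification of the weak gradient. -/
theorem fderiv_mollify_apply (φ : ContDiffBump (0 : EuclideanSpace ℝ (Fin N)))
    (h : HardyStability.IsWeakGradient u G) (x e : EuclideanSpace ℝ (Fin N)) :
    fderiv ℝ (mollify φ u) x e = inner ℝ (∫ y, φ.normed volume (x - y) • G y) e := by
  have hρ : ContDiff ℝ ∞ (φ.normed volume) := φ.contDiff_normed
  have hρ1 : ContDiff ℝ 1 (φ.normed volume) := φ.contDiff_normed (n := 1)
  have hρs := φ.hasCompactSupport_normed (μ := volume)
  have hcont : Continuous (fderiv ℝ (φ.normed volume)) := hρ1.continuous_fderiv one_ne_zero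
  have e0 : mollify φ u =
      convolution u (φ.normed volume) (ContinuousLinearMap.lsmul ℝ ℝ).flip volume :=
    (convolution_flip _).symm
  rw [e0, (hρs.hasFDerivAt_convolution_right _ h.locallyIntegrable hρ1 x).fderiv,
    convolution_precompR_apply _ h.locallyIntegrable (hρs.fderiv ℝ) hcont]
  have hψ : ContDiff ℝ ∞ fun y => φ.normed volume (x - y) :=
    hρ.comp (contDiff_const.sub contDiff_id)
  have hψs : HasCompactSupport fun y => φ.normed volume (x - y) :=
    hρs.comp_homeomorph (Homeomorph.subLeft x)
  have hψd : ∀ y, fderiv ℝ (fun y => φ.normed volume (x - y)) y e =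
      -fderiv ℝ (φ.normed volume) (x - y) e := by
    intro y
    have h1 : HasFDerivAt (fun y : EuclideanSpace ℝ (Fin N) => x - y)
        (-ContinuousLinearMap.id ℝ _) y := (hasFDerivAt_id y).const_sub x
    have h2 := ((hρ1.differentiable one_ne_zero (x - y)).hasFDerivAt.comp y h1).fderiv
    simp only [Function.comp_def] at h2
    rw [h2]; simp
  have hint : Integrable (fun y => φ.normed volume (x - y) • G y) volume :=
    h.locallyIntegrable_grad.integrable_smul_left_of_hasCompactSupport hψ.continuous hψs
  have hw := h.integral_eq _ hψ hψs e
  simp_rw [hψd, mul_neg, integral_neg, neg_inj] at hw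
  rw [convolution_def]
  simp only [ContinuousLinearMap.flip_apply, ContinuousLinearMap.lsmul_apply, smul_eq_mul]
  rw [real_inner_comm, ← integral_inner hint]
  have hsw : ∀ y, inner ℝ e (φ.normed volume (x - y) • G y) =
      φ.normed volume (x - y) * inner ℝ (G y) e := fun y => by
    rw [inner_smul_right, real_inner_comm]
  simp_rw [hsw]
  rw [← hw]
  exact integral_congr_ae (.of_forall fun y => mul_comm _ _)

theorem enorm_fderiv_mollify_le (φ : ContDiffBump (0 : EuclideanSpace ℝ (Fin N)))
    (h : HardyStability.IsWeakGradient u G) (x : EuclideanSpace ℝ (Fin N)) :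
    ‖fderiv ℝ (mollify φ u) x‖ₑ ≤ ∫⁻ y, ENNReal.ofReal (φ.normed volume (x - y)) * ‖G y‖ₑ := by
  have h1 : fderiv ℝ (mollify φ u) x = innerSL ℝ (∫ y, φ.normed volume (x - y) • G y) := by
    ext e
    rw [fderiv_mollify_apply φ h, innerSL_apply_apply]
  have h2 : ‖fderiv ℝ (mollify φ u) x‖ₑ = ‖∫ y, φ.normed volume (x - y) • G y‖ₑ := by
    rw [h1, ← ofReal_norm, innerSL_apply_norm, ofReal_norm]
  rw [h2]
  refine (enorm_integral_le_lintegral_enorm _).trans (le_of_eq (lintegral_congr fun y => ?_))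
  rw [enorm_smul, Real.enorm_eq_ofReal (φ.nonneg_normed _)]

/-- Jensen's inequality for an average with respect to a probability density. -/
theorem lintegral_mul_rpow_le {α : Type*} [MeasurableSpace α] {μ : Measure α} {p : ℝ} (hp : 1 < p)
    {ρ g : α → ℝ≥0∞} (hρ : Measurable ρ) (hρ1 : ∫⁻ y, ρ y ∂μ = 1) (hg : AEMeasurable g μ) :
    (∫⁻ y, ρ y * g y ∂μ) ^ p ≤ ∫⁻ y, ρ y * g y ^ p ∂μ := by
  have hp0 : 0 < p := by linarith
  have hpq := (Real.HolderConjugate.conjExponent hp).symm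
  set q := p.conjExponent
  have hq0 : 0 < q := hpq.pos
  -- Hölder with `ρ` split as `ρ ^ (1 / q) * ρ ^ (1 / p)`; the first factor has unit norm.
  have hH := ENNReal.lintegral_mul_le_Lp_mul_Lq μ hpq (hρ.pow_const (1 / q)).aemeasurable
    ((hρ.pow_const (1 / p)).aemeasurable.mul hg)
  have e1 : ∀ y, ρ y ^ (1 / q) * (ρ y ^ (1 / p) * g y) = ρ y * g y := by
    intro y
    rw [← mul_assoc, ← ENNReal.rpow_add_of_nonneg _ _ (by positivity) (by positivity), one_div,
      one_div, hpq.inv_add_inv_eq_one, ENNReal.rpow_one]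
  have e2 : ∀ y, (ρ y ^ (1 / q)) ^ q = ρ y := fun y => by
    rw [← ENNReal.rpow_mul, one_div_mul_cancel hq0.ne', ENNReal.rpow_one]
  have e3 : ∀ y, (ρ y ^ (1 / p) * g y) ^ p = ρ y * g y ^ p := fun y => by
    rw [ENNReal.mul_rpow_of_nonneg _ _ hp0.le, ← ENNReal.rpow_mul, one_div_mul_cancel hp0.ne',
      ENNReal.rpow_one]
  simp only [Pi.mul_apply, e1, e2, e3, hρ1, ENNReal.one_rpow, one_mul] at hH
  calc _ ≤ ((∫⁻ y, ρ y * g y ^ p ∂μ) ^ (1 / p)) ^ p := ENNReal.rpow_le_rpow hH hp0.le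
    _ = _ := by rw [← ENNReal.rpow_mul, one_div_mul_cancel hp0.ne', ENNReal.rpow_one]

theorem lintegral_fderiv_mollify_le (φ : ContDiffBump (0 : EuclideanSpace ℝ (Fin N)))
    (h : HardyStability.IsWeakGradient u G) {p : ℝ} (hp : 1 < p) :
    ∫⁻ x, ‖fderiv ℝ (mollify φ u) x‖ₑ ^ p ≤ ∫⁻ x, ‖G x‖ₑ ^ p := by
  have hp0 : 0 < p := by linarith
  have hρm : Measurable fun x => ENNReal.ofReal (φ.normed volume x) :=
    φ.continuous_normed.measurable.ennreal_ofReal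
  have hρ1 : ∫⁻ x, ENNReal.ofReal (φ.normed volume x) = 1 := by
    rw [← ofReal_integral_eq_lintegral_ofReal φ.integrable_normed
      (.of_forall fun x => φ.nonneg_normed x), φ.integral_normed, ENNReal.ofReal_one]
  have hG : AEMeasurable (fun y => ‖G y‖ₑ) volume :=
    h.locallyIntegrable_grad.aestronglyMeasurable.enorm
  calc ∫⁻ x, ‖fderiv ℝ (mollify φ u) x‖ₑ ^ p
      ≤ ∫⁻ x, ∫⁻ y, ENNReal.ofReal (φ.normed volume (x - y)) * ‖G y‖ₑ ^ p := by
        refine lintegral_mono fun x => ?_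
        refine (ENNReal.rpow_le_rpow (enorm_fderiv_mollify_le φ h x) hp0.le).trans ?_
        refine lintegral_mul_rpow_le hp (hρm.comp (measurable_const.sub measurable_id)) ?_ hG
        rw [← hρ1]
        exact lintegral_sub_left_eq_self (fun y => ENNReal.ofReal (φ.normed volume y)) x
    _ = ∫⁻ y, ∫⁻ x, ENNReal.ofReal (φ.normed volume (x - y)) * ‖G y‖ₑ ^ p := by
        refine lintegral_lintegral_swap ?_
        refine AEMeasurable.mul ?_ (hG.pow_const p).comp_snd
        exact (hρm.comp (measurable_fst.sub measurable_snd)).aemeasurable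
    _ = ∫⁻ y, ‖G y‖ₑ ^ p := by
        refine lintegral_congr fun y => ?_
        rw [lintegral_mul_const _ (show Measurable fun x => ENNReal.ofReal (φ.normed volume (x - y)) from
          hρm.comp (measurable_id.sub measurable_const))]
        have : ∫⁻ x, ENNReal.ofReal (φ.normed volume (x - y)) = 1 := by
          rw [← hρ1]
          exact lintegral_sub_right_eq_self (fun x => ENNReal.ofReal (φ.normed volume x)) y
        rw [this, one_mul]

theorem exists_mollifier_tendsto (N : ℕ) :
    ∃ φ : ℕ → ContDiffBump (0 : EuclideanSpace ℝ (Fin N)),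
      ∀ u : EuclideanSpace ℝ (Fin N) → ℝ, LocallyIntegrable u volume →
        ∀ᵐ x, Tendsto (fun n => mollify (φ n) u x) atTop (𝓝 (u x)) := by
  refine ⟨fun n => ⟨1 / ((n : ℝ) + 1), 2 * (1 / ((n : ℝ) + 1)), by positivity, by
    have : 0 < 1 / ((n : ℝ) + 1) := by positivity
    linarith⟩, fun u hu => ?_⟩
  refine ContDiffBump.ae_convolution_tendsto_right_of_locallyIntegrable (K := 2) ?_ ?_ hu
  · simpa using (tendsto_one_div_add_atTop_nhds_zero_nat (𝕜 := ℝ)).const_mul 2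
  · exact .of_forall fun n => le_rfl

end Mollification

/-! ### Nonexpansive truncations of the values. -/

section Truncation

open Filter Topology

/-- There are bounded, nonexpansive `C¹` truncations, vanishing near zero, converging to the
identity. -/
theorem exists_truncation : ∃ T : ℕ → ℝ → ℝ, (∀ n, ContDiff ℝ 1 (T n)) ∧
    (∀ n σ, |deriv (T n) σ| ≤ 1) ∧ (∀ n, ∃ M, ∀ σ, |T n σ| ≤ M) ∧
    (∀ n, ∃ ε > 0, ∀ σ, |σ| ≤ ε → T n σ = 0) ∧ ∀ σ, Tendsto (fun n => T n σ) atTop (𝓝 σ) := by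
  -- The truncation is the primitive of `θ n`. The first factor vanishes near zero and the second is
  -- integrable, which makes the primitive bounded; both lie in `[0, 1]` and tend to 1 off zero.
  let θ : ℕ → ℝ → ℝ := fun n τ =>
    max 0 (min 1 (((n : ℝ) + 1) * |τ| - 1)) * (1 + (τ / ((n : ℝ) + 1)) ^ 2)⁻¹
  have hn : ∀ n : ℕ, (0 : ℝ) < (n : ℝ) + 1 := fun n => by positivity
  have hθc : ∀ n, Continuous (θ n) := by
    intro n
    refine Continuous.mul (by fun_prop) (Continuous.inv₀ (by fun_prop) fun τ => by positivity)
  have hθ1 : ∀ n τ, |max 0 (min 1 (((n : ℝ) + 1) * |τ| - 1))| ≤ 1 := fun n τ => by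
    rw [abs_of_nonneg (le_max_left _ _)]
    exact max_le zero_le_one (min_le_left _ _)
  have hinv : ∀ (n : ℕ) (τ : ℝ), 0 ≤ (1 + (τ / ((n : ℝ) + 1)) ^ 2)⁻¹ := fun n τ => by positivity
  have hθle : ∀ n τ, |θ n τ| ≤ (1 + (τ / ((n : ℝ) + 1)) ^ 2)⁻¹ := by
    intro n τ
    simp only [θ]
    rw [abs_mul, abs_of_nonneg (hinv n τ)]
    exact mul_le_of_le_one_left (hinv n τ) (hθ1 n τ)
  have hinv1 : ∀ (n : ℕ) (τ : ℝ), (1 + (τ / ((n : ℝ) + 1)) ^ 2)⁻¹ ≤ 1 := fun n τ =>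
    inv_le_one_of_one_le₀ (by linarith [sq_nonneg (τ / ((n : ℝ) + 1))])
  have hder : ∀ n σ, HasDerivAt (fun σ => ∫ τ in (0 : ℝ)..σ, θ n τ) (θ n σ) σ := fun n σ =>
    intervalIntegral.integral_hasDerivAt_right ((hθc n).intervalIntegrable _ _)
      ((hθc n).stronglyMeasurableAtFilter _ _) (hθc n).continuousAt
  have hdeq : ∀ n, deriv (fun σ => ∫ τ in (0 : ℝ)..σ, θ n τ) = θ n := fun n =>
    funext fun σ => (hder n σ).deriv
  refine ⟨fun n σ => ∫ τ in (0 : ℝ)..σ, θ n τ, fun n => ?_, fun n σ => ?_, fun n => ?_, fun n => ?_,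
    fun σ => ?_⟩
  · rw [contDiff_one_iff_deriv, hdeq n]
    exact ⟨fun σ => (hder n σ).differentiableAt, hθc n⟩
  · rw [hdeq n]
    exact (hθle n σ).trans (hinv1 n σ)
  · have hi : Integrable fun τ : ℝ => (1 + (τ / ((n : ℝ) + 1)) ^ 2)⁻¹ :=
      integrable_inv_one_add_sq.comp_div (hn n).ne'
    refine ⟨∫ τ : ℝ, (1 + (τ / ((n : ℝ) + 1)) ^ 2)⁻¹, fun σ => ?_⟩
    rw [← Real.norm_eq_abs]
    refine intervalIntegral.norm_integral_le_integral_norm_uIoc.trans ?_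
    refine le_trans (integral_mono_of_nonneg (.of_forall fun τ => norm_nonneg _) hi.integrableOn
      (.of_forall fun τ => hθle n τ)) ?_
    exact setIntegral_le_integral hi (.of_forall fun τ => hinv n τ)
  · refine ⟨1 / ((n : ℝ) + 1), one_div_pos.2 (hn n), fun σ hσ => ?_⟩
    refine intervalIntegral.integral_zero_ae (.of_forall fun τ hτ => ?_)
    have h1 : |τ| ≤ |σ| := by
      rcases le_total 0 σ with h | h
      · rw [uIoc_of_le h] at hτ
        rw [abs_of_pos hτ.1, abs_of_nonneg h]; exact hτ.2
      · rw [uIoc_of_ge h] at hτ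
        rw [abs_of_nonpos hτ.2, abs_of_nonpos h]; linarith [hτ.1]
    have h2 : ((n : ℝ) + 1) * |τ| - 1 ≤ 0 := by
      have := h1.trans hσ
      rw [le_div_iff₀ (hn n)] at this
      linarith
    simp only [θ]
    rw [max_eq_left ((min_le_right _ _).trans h2), zero_mul]
  · have hlim : Tendsto (fun n : ℕ => ∫ τ in (0 : ℝ)..σ, θ n τ) atTop
        (𝓝 (∫ τ in (0 : ℝ)..σ, (1 : ℝ))) := by
      refine intervalIntegral.tendsto_integral_filter_of_dominated_convergence (fun _ => 1)
        (.of_forall fun n => (hθc n).aestronglyMeasurable)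
        (.of_forall fun n => .of_forall fun τ _ => (hθle n τ).trans (hinv1 n τ))
        intervalIntegrable_const ?_
      have h0 : ∀ᵐ τ : ℝ, τ ≠ 0 := by simp [ae_iff]
      filter_upwards [h0] with τ hτ _
      have hτ' : 0 < |τ| := abs_pos.2 hτ
      have hT : Tendsto (fun n : ℕ => (n : ℝ) + 1) atTop atTop :=
        tendsto_atTop_add_const_right _ _ tendsto_natCast_atTop_atTop
      have h1 : Tendsto (fun n : ℕ => (1 + (τ / ((n : ℝ) + 1)) ^ 2)⁻¹) atTop (𝓝 1) := by
        have := ((((tendsto_const_nhds (x := τ)).div_atTop hT).pow 2).const_add 1).inv₀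
          (by norm_num)
        simpa using this
      refine h1.congr' ?_
      filter_upwards [hT.eventually_ge_atTop (2 / |τ|)] with n hn2
      rw [div_le_iff₀ hτ'] at hn2
      simp only [θ]
      rw [min_eq_left (by linarith), max_eq_right zero_le_one, one_mul]
    simpa using hlim

end Truncation

/-! ### Passage from test functions to the homogeneous Sobolev space. -/

section Approximation

open Module Filter Topology

variable {N : ℕ}

/-- Energy of a truncated and cut off function. -/
theorem lintegral_fderiv_cutoff_mul_le {p : ℝ} (hp : 1 < p)
    {η w : EuclideanSpace ℝ (Fin N) → ℝ} {T : ℝ → ℝ} {m : ℝ}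
    (hη : ContDiff ℝ 1 η) (hη1 : ∀ x, |η x| ≤ 1) (hηm : ∀ x, ‖fderiv ℝ η x‖ ≤ m)
    (hT : ContDiff ℝ 1 T) (hT1 : ∀ σ, |deriv T σ| ≤ 1) (hw : ContDiff ℝ 1 w) :
    ∫⁻ x, ‖fderiv ℝ (fun x => η x * T (w x)) x‖ₑ ^ p ≤
      ((∫⁻ x, ‖fderiv ℝ w x‖ₑ ^ p) ^ (1 / p) + ENNReal.ofReal m *
        (∫⁻ x in tsupport η, ENNReal.ofReal (|T (w x)| ^ p)) ^ (1 / p)) ^ p := by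
  have hp0 : 0 < p := by linarith
  have hm0 : 0 ≤ m := (norm_nonneg _).trans (hηm 0)
  let S : EuclideanSpace ℝ (Fin N) → ℝ≥0∞ := (tsupport η).indicator fun x =>
    ENNReal.ofReal m * ENNReal.ofReal |T (w x)|
  have hS : Measurable S := by
    refine Measurable.indicator ?_ (isClosed_tsupport η).measurableSet
    exact ((hT.continuous.comp hw.continuous).abs.measurable.ennreal_ofReal).const_mul _
  have hpt : ∀ x, ‖fderiv ℝ (fun x => η x * T (w x)) x‖ₑ ≤ ‖fderiv ℝ w x‖ₑ + S x := by
    intro x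
    have h1 := (hη.differentiable one_ne_zero x).hasFDerivAt.mul
      ((hT.differentiable one_ne_zero (w x)).hasDerivAt.comp_hasFDerivAt x
        (hw.differentiable one_ne_zero x).hasFDerivAt)
    have h2 : fderiv ℝ (fun x => η x * T (w x)) x =
        η x • deriv T (w x) • fderiv ℝ w x + T (w x) • fderiv ℝ η x := h1.fderiv
    have h3 : ‖η x • deriv T (w x) • fderiv ℝ w x‖ ≤ ‖fderiv ℝ w x‖ := by
      rw [norm_smul, norm_smul, ← mul_assoc]
      exact mul_le_of_le_one_left (norm_nonneg _)
        (mul_le_one₀ (hη1 x) (norm_nonneg _) (hT1 _))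
    rw [h2]
    refine (enorm_add_le (η x • deriv T (w x) • fderiv ℝ w x)
      (T (w x) • fderiv ℝ η x)).trans (add_le_add ?_ ?_)
    · rw [← ofReal_norm, ← ofReal_norm]
      exact ENNReal.ofReal_le_ofReal h3
    · by_cases hx : x ∈ tsupport η
      · simp only [S]
        rw [indicator_of_mem hx, ← ofReal_norm, norm_smul, ← ENNReal.ofReal_mul hm0, mul_comm m]
        refine ENNReal.ofReal_le_ofReal ?_
        rw [Real.norm_eq_abs]
        gcongr
        exact hηm x
      · have : fderiv ℝ η x = 0 := by
          by_contra h
          exact hx (support_fderiv_subset ℝ h)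
        rw [this, smul_zero, ← ofReal_norm, norm_zero, ENNReal.ofReal_zero]
        exact zero_le
  have hSp : ∫⁻ x, S x ^ p = ENNReal.ofReal m ^ p *
      ∫⁻ x in tsupport η, ENNReal.ofReal (|T (w x)| ^ p) := by
    rw [← lintegral_const_mul' _ _ (ENNReal.rpow_ne_top_of_nonneg hp0.le ENNReal.ofReal_ne_top),
      ← lintegral_indicator (isClosed_tsupport η).measurableSet]
    refine lintegral_congr fun x => ?_
    by_cases hx : x ∈ tsupport η
    · simp only [S]
      rw [indicator_of_mem hx, indicator_of_mem hx, ENNReal.mul_rpow_of_nonneg _ _ hp0.le,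
        ENNReal.ofReal_rpow_of_nonneg (abs_nonneg _) hp0.le]
    · simp only [S]
      rw [indicator_of_notMem hx, indicator_of_notMem hx, ENNReal.zero_rpow_of_pos hp0]
  have hL := ENNReal.lintegral_Lp_add_le (μ := volume) (p := p)
    (hw.continuous_fderiv one_ne_zero).enorm.measurable.aemeasurable hS.aemeasurable hp.le
  rw [hSp, ENNReal.mul_rpow_of_nonneg _ _ (by positivity : 0 ≤ 1 / p), ← ENNReal.rpow_mul,
    mul_one_div_cancel hp0.ne', ENNReal.rpow_one] at hL
  calc _ ≤ ∫⁻ x, (‖fderiv ℝ w x‖ₑ + S x) ^ p :=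
        lintegral_mono fun x => ENNReal.rpow_le_rpow (hpt x) hp0.le
    _ = ((∫⁻ x, (‖fderiv ℝ w x‖ₑ + S x) ^ p) ^ (1 / p)) ^ p := by
        rw [← ENNReal.rpow_mul, one_div_mul_cancel hp0.ne', ENNReal.rpow_one]
    _ ≤ _ := ENNReal.rpow_le_rpow hL hp0.le

theorem tendsto_add_mul_rpow {p : ℝ} (hp : 0 < p) {g A : ℝ≥0∞} (hA : A ≠ ⊤) {b : ℕ → ℝ≥0∞}
    {b₀ : ℝ≥0∞} (hb : Tendsto b atTop (𝓝 b₀)) :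
    Tendsto (fun n => (g ^ (1 / p) + b n * A ^ (1 / p)) ^ p) atTop
      (𝓝 ((g ^ (1 / p) + b₀ * A ^ (1 / p)) ^ p)) :=
  (((ENNReal.Tendsto.mul_const hb
    (Or.inr (ENNReal.rpow_ne_top_of_nonneg (by positivity) hA))).const_add _)).ennrpow_const p

/-- Energy bounds for test functions extend to the homogeneous Sobolev space. -/
theorem energyBounds_of_isWeakGradient {p q c C : ℝ} (hp : 1 < p) (hq : 0 < q)
    (hC : ∀ f : EuclideanSpace ℝ (Fin N) → ℝ, ContDiff ℝ 1 f → HasCompactSupport f →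
      EnergyBounds volume p q c C f (∫⁻ x, ‖fderiv ℝ f x‖ₑ ^ p))
    {u : EuclideanSpace ℝ (Fin N) → ℝ} {G : EuclideanSpace ℝ (Fin N) → EuclideanSpace ℝ (Fin N)}
    (h : HardyStability.IsWeakGradient u G) (hdec : HardyStability.DecaysAtInfinity u) :
    EnergyBounds volume p q c C u (∫⁻ x, ‖G x‖ₑ ^ p) := by
  have hp0 : 0 < p := by linarith
  obtain ⟨T, hTc, hT1, hTb, hT0, hTlim⟩ := exists_truncation
  obtain ⟨φ, hφ⟩ := exists_mollifier_tendsto N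
  have hφu := hφ u h.locallyIntegrable
  have hum : AEMeasurable u volume := h.locallyIntegrable.aestronglyMeasurable.aemeasurable
  set g := ∫⁻ x, ‖G x‖ₑ ^ p
  let η₀ : ContDiffBump (0 : EuclideanSpace ℝ (Fin N)) := ⟨1, 2, one_pos, one_lt_two⟩
  have hη₀ : ContDiff ℝ 1 η₀ := η₀.contDiff
  obtain ⟨M, hM⟩ := (η₀.hasCompactSupport.fderiv ℝ).exists_bound_of_continuous
    (hη₀.continuous_fderiv one_ne_zero)
  let η : ℕ → EuclideanSpace ℝ (Fin N) → ℝ := fun m x => η₀ (((m : ℝ) + 1)⁻¹ • x)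
  have hpos : ∀ m : ℕ, (0 : ℝ) < ((m : ℝ) + 1)⁻¹ := fun m => by positivity
  have hηc : ∀ m, ContDiff ℝ 1 (η m) := fun m => hη₀.comp (contDiff_const_smul _)
  have hηs : ∀ m, HasCompactSupport (η m) := fun m =>
    η₀.hasCompactSupport.comp_smul (hpos m).ne'
  have hη1 : ∀ m x, |η m x| ≤ 1 := fun m x => by
    rw [abs_of_nonneg η₀.nonneg]; exact η₀.le_one
  have hηM : ∀ m x, ‖fderiv ℝ (η m) x‖ ≤ M * ((m : ℝ) + 1)⁻¹ := by
    intro m x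
    have h1 : HasFDerivAt (fun x : EuclideanSpace ℝ (Fin N) => ((m : ℝ) + 1)⁻¹ • x)
        (((m : ℝ) + 1)⁻¹ • ContinuousLinearMap.id ℝ _) x :=
      (((m : ℝ) + 1)⁻¹ • ContinuousLinearMap.id ℝ (EuclideanSpace ℝ (Fin N))).hasFDerivAt
    have h2 : fderiv ℝ (η m) x = ((m : ℝ) + 1)⁻¹ • fderiv ℝ η₀ (((m : ℝ) + 1)⁻¹ • x) := by
      have := ((hη₀.differentiable one_ne_zero _).hasFDerivAt.comp x h1).fderiv
      simp only [Function.comp_def] at this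
      simp only [η]
      rw [this]
      ext e
      simp
    rw [h2, norm_smul, Real.norm_of_nonneg (hpos m).le, mul_comm]
    gcongr
    exact hM _
  have hηlim : ∀ x, Tendsto (fun m => η m x) atTop (𝓝 1) := by
    intro x
    have h1 : Tendsto (fun m : ℕ => (((m : ℝ) + 1)⁻¹ : ℝ) • x) atTop (𝓝 ((0 : ℝ) • x)) := by
      simpa [one_div] using
        (tendsto_one_div_add_atTop_nhds_zero_nat (𝕜 := ℝ)).smul_const x
    rw [zero_smul] at h1
    have h2 := (hη₀.continuous.tendsto 0).comp h1
    rwa [η₀.one_of_mem_closedBall (by simp [η₀])] at h2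
  -- remove the mollification
  have step1 : ∀ n m, EnergyBounds volume p q c C (fun x => η m x * T n (u x))
      ((g ^ (1 / p) + ENNReal.ofReal (M * ((m : ℝ) + 1)⁻¹) *
        (∫⁻ x in tsupport (η m), ENNReal.ofReal (|T n (u x)| ^ p)) ^ (1 / p)) ^ p) := by
    intro n m
    obtain ⟨K, hK⟩ := hTb n
    have hwc : ∀ k, ContDiff ℝ 1 (mollify (φ k) u) := fun k =>
      contDiff_mollify (φ k) h.locallyIntegrable
    refine EnergyBounds.of_tendsto (v := fun k x => η m x * T n (mollify (φ k) u x))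
      (h := fun k => (g ^ (1 / p) + ENNReal.ofReal (M * ((m : ℝ) + 1)⁻¹) *
        (∫⁻ x in tsupport (η m), ENNReal.ofReal (|T n (mollify (φ k) u x)| ^ p)) ^ (1 / p)) ^ p)
      hp0 hq (fun k => ?_) ?_ ?_ fun k => ?_
    · exact ((hηc m).continuous.mul
        ((hTc n).continuous.comp (hwc k).continuous)).measurable.aemeasurable
    · filter_upwards [hφu] with x hx
      exact (((hTc n).continuous.tendsto _).comp hx).const_mul _
    · have hd : Tendsto (fun k => ∫⁻ x in tsupport (η m),
          ENNReal.ofReal (|T n (mollify (φ k) u x)| ^ p)) atTop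
          (𝓝 (∫⁻ x in tsupport (η m), ENNReal.ofReal (|T n (u x)| ^ p))) := by
        refine tendsto_lintegral_of_dominated_convergence' (fun _ => ENNReal.ofReal (K ^ p))
          (fun k => ?_) (fun k => .of_forall fun x => ?_) ?_ ?_
        · exact (((hTc n).continuous.comp (hwc k).continuous).abs.measurable.pow_const
            p).ennreal_ofReal.aemeasurable
        · exact ENNReal.ofReal_le_ofReal
            (Real.rpow_le_rpow (abs_nonneg _) (hK _) hp0.le)
        · rw [lintegral_const, Measure.restrict_apply_univ]
          exact ENNReal.mul_ne_top ENNReal.ofReal_ne_top (hηs m).isCompact.measure_lt_top.ne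
        · filter_upwards [ae_restrict_of_ae hφu] with x hx
          exact ENNReal.tendsto_ofReal
            ((((hTc n).continuous.tendsto _).comp hx).abs.rpow_const (Or.inr hp0.le))
      exact ((ENNReal.Tendsto.const_mul (hd.ennrpow_const _)
        (Or.inr ENNReal.ofReal_ne_top)).const_add _).ennrpow_const p
    · refine (hC _ ((hηc m).mul ((hTc n).comp (hwc k))) ?_).mono ?_
      · exact (hηs m).mul_right
      · refine (lintegral_fderiv_cutoff_mul_le hp (hηc m) (hη1 m) (hηM m) (hTc n) (hT1 n)
          (hwc k)).trans ?_
        gcongr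
        exact lintegral_fderiv_mollify_le (φ k) h hp
  -- remove the cutoff
  have step2 : ∀ n, EnergyBounds volume p q c C (fun x => T n (u x)) g := by
    intro n
    obtain ⟨K, hK⟩ := hTb n
    obtain ⟨ε, hε, hTε⟩ := hT0 n
    -- The decay assumption is used here: `T n (u x)` is bounded and vanishes off a superlevel set
    -- of finite measure. Hence the gradient of the cutoff, of size `M / (m + 1)`, contributes
    -- nothing in the limit.
    have hA : ∫⁻ x, ENNReal.ofReal (|T n (u x)| ^ p) ≠ ⊤ := by
      have hms : NullMeasurableSet {x | ε < |u x|} volume :=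
        nullMeasurableSet_lt aemeasurable_const hum.abs
      refine ne_top_of_le_ne_top (b := ∫⁻ x, ({x | ε < |u x|}).indicator
        (fun _ => ENNReal.ofReal (K ^ p)) x) ?_ (lintegral_mono fun x => ?_)
      · rw [lintegral_indicator_const₀ hms]
        exact ENNReal.mul_ne_top ENNReal.ofReal_ne_top (hdec ε hε).ne
      · by_cases hx : ε < |u x|
        · rw [indicator_of_mem (by exact hx)]
          exact ENNReal.ofReal_le_ofReal (Real.rpow_le_rpow (abs_nonneg _) (hK _) hp0.le)
        · simp [hTε _ (not_lt.1 hx), Real.zero_rpow hp0.ne']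
    have hb0 : Tendsto (fun m : ℕ => ENNReal.ofReal (M * ((m : ℝ) + 1)⁻¹)) atTop (𝓝 0) := by
      have : Tendsto (fun m : ℕ => M * ((m : ℝ) + 1)⁻¹) atTop (𝓝 0) := by
        simpa [one_div] using
          (tendsto_one_div_add_atTop_nhds_zero_nat (𝕜 := ℝ)).const_mul M
      simpa using ENNReal.tendsto_ofReal this
    refine EnergyBounds.of_tendsto (v := fun m x => η m x * T n (u x))
      (h := fun m => (g ^ (1 / p) + ENNReal.ofReal (M * ((m : ℝ) + 1)⁻¹) *
        (∫⁻ x, ENNReal.ofReal (|T n (u x)| ^ p)) ^ (1 / p)) ^ p)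
      hp0 hq (fun m => ?_) ?_ ?_ fun m => (step1 n m).mono ?_
    · exact (hηc m).continuous.measurable.aemeasurable.mul
        ((hTc n).continuous.measurable.comp_aemeasurable hum)
    · exact .of_forall fun x => by simpa using (hηlim x).mul_const (T n (u x))
    · have := tendsto_add_mul_rpow hp0 (g := g) hA hb0
      rwa [zero_mul, add_zero, ← ENNReal.rpow_mul, one_div_mul_cancel hp0.ne',
        ENNReal.rpow_one] at this
    · gcongr
      exact Measure.restrict_le_self
  exact EnergyBounds.of_tendsto (v := fun n x => T n (u x)) (h := fun _ => g) hp0 hq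
    (fun n => (hTc n).continuous.measurable.comp_aemeasurable hum)
    (.of_forall fun x => hTlim _) tendsto_const_nhds step2

end Approximation

/-! ### Weak and Lorentz norms through the distribution function. -/

section Rearrangement

open Filter Topology HardyStability

theorem lintegral_rpow_sub_one_indicator {r : ℝ} (hr : 0 < r) {y : ℝ} (hy : 0 ≤ y) :
    ENNReal.ofReal r * ∫⁻ s in Ioi (0 : ℝ), ENNReal.ofReal (s ^ (r - 1)) *
      (Iio y).indicator 1 s = ENNReal.ofReal (y ^ r) := by
  have h := lintegral_rpow_eq_lintegral_meas_lt_mul (Measure.dirac ()) (f := fun _ => y)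
    (.of_forall fun _ => hy) aemeasurable_const hr
  rw [lintegral_dirac] at h
  rw [h]
  congr 1
  refine lintegral_congr fun s => ?_
  rw [mul_comm]
  congr 1
  by_cases hs : s < y <;> simp [hs]

variable {N : ℕ}

theorem distribution_antitone (f : EuclideanSpace ℝ (Fin N) → ℝ) : Antitone (distribution f) :=
  fun _ _ hab => measure_mono fun _ hx => lt_of_le_of_lt hab hx

theorem decreasingRearrangement_le {f : EuclideanSpace ℝ (Fin N) → ℝ} {s t : ℝ} (hs : 0 < s)
    (h : distribution f s ≤ ENNReal.ofReal t) : decreasingRearrangement f t ≤ ENNReal.ofReal s :=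
  iInf₂_le s ⟨hs, h⟩

theorem distribution_le_of_decreasingRearrangement_lt {f : EuclideanSpace ℝ (Fin N) → ℝ} {s t : ℝ}
    (h : decreasingRearrangement f t < ENNReal.ofReal s) :
    distribution f s ≤ ENNReal.ofReal t := by
  simp only [decreasingRearrangement, iInf_lt_iff] at h
  obtain ⟨s', ⟨hs', hd⟩, hlt⟩ := h
  exact (distribution_antitone f (ENNReal.ofReal_lt_ofReal_iff_of_nonneg hs'.le |>.1 hlt).le).trans
    hd

/-- The weak Lebesgue quasi-norm is controlled by the distribution function. -/
theorem weakNorm_le {f : EuclideanSpace ℝ (Fin N) → ℝ} {r : ℝ} (hr : 0 < r) {K : ℝ≥0∞}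
    (h : ∀ s : ℝ, 0 < s → ENNReal.ofReal s * distribution f s ^ (1 / r) ≤ K) :
    weakNorm r f ≤ K := by
  refine iSup₂_le fun t ht => ?_
  by_contra! hlt
  have ht' : 0 < t ^ (1 / r) := by positivity
  have h1 : K / ENNReal.ofReal (t ^ (1 / r)) < decreasingRearrangement f t := by
    rw [ENNReal.div_lt_iff (Or.inl (by simpa using ht')) (Or.inl ENNReal.ofReal_ne_top), mul_comm]
    exact hlt
  obtain ⟨s, hs1, hs2⟩ := ENNReal.lt_iff_exists_nnreal_btwn.1 h1
  have hs0 : 0 < (s : ℝ) := by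
    have : (0 : ℝ≥0∞) < s := lt_of_le_of_lt zero_le hs1
    exact_mod_cast this
  have hμ : ENNReal.ofReal t < distribution f s := by
    by_contra! hle
    have := decreasingRearrangement_le hs0 hle
    rw [ENNReal.ofReal_coe_nnreal] at this
    exact absurd hs2 (not_lt.2 this)
  rw [ENNReal.div_lt_iff (Or.inl (by simpa using ht')) (Or.inl ENNReal.ofReal_ne_top)] at hs1
  refine absurd (h s hs0) (not_le.2 (hs1.trans_le ?_))
  rw [ENNReal.ofReal_coe_nnreal, ← ENNReal.ofReal_rpow_of_pos ht]
  gcongr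

theorem decreasingRearrangement_rpow {f : EuclideanSpace ℝ (Fin N) → ℝ} {p t : ℝ} (hp : 0 < p)
    (hfin : decreasingRearrangement f t ≠ ⊤) :
    decreasingRearrangement f t ^ p = ENNReal.ofReal p * ∫⁻ s in Ioi (0 : ℝ),
      ENNReal.ofReal (s ^ (p - 1)) *
        {s | ENNReal.ofReal t < distribution f s}.indicator 1 s := by
  set y := (decreasingRearrangement f t).toReal with hy
  have hyeq : decreasingRearrangement f t = ENNReal.ofReal y := (ENNReal.ofReal_toReal hfin).symm
  have hy0 : 0 ≤ y := ENNReal.toReal_nonneg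
  rw [hyeq, ENNReal.ofReal_rpow_of_nonneg hy0 hp.le, ← lintegral_rpow_sub_one_indicator hp hy0]
  congr 1
  refine lintegral_congr_ae ?_
  -- The conditions `s < f^*(t)` and `t < μ_f(s)` are shown equivalent except possibly at `s =
  -- f^*(t)`, which is a null set.
  have hne : ∀ᵐ s : ℝ, s ≠ y := by simp [ae_iff]
  filter_upwards [ae_restrict_mem measurableSet_Ioi, ae_restrict_of_ae hne] with s hs hsy
  have hs : 0 < s := hs
  congr 1
  rcases lt_or_gt_of_ne hsy with h | h
  · have : ENNReal.ofReal t < distribution f s := by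
      by_contra! hle
      have := decreasingRearrangement_le hs hle
      rw [hyeq, ENNReal.ofReal_le_ofReal_iff hs.le] at this
      linarith
    rw [indicator_of_mem (by exact h), indicator_of_mem (by exact this)]
  · have : ¬ ENNReal.ofReal t < distribution f s := by
      refine not_lt.2 (distribution_le_of_decreasingRearrangement_lt ?_)
      rw [hyeq]
      exact (ENNReal.ofReal_lt_ofReal_iff hs).2 h
    rw [indicator_of_notMem (by exact not_lt.2 h.le), indicator_of_notMem (by exact this)]

/-- The Lorentz norm in terms of the distribution function. -/
theorem lorentzNorm_rpow {f : EuclideanSpace ℝ (Fin N) → ℝ} {p q : ℝ} (hp : 0 < p) (hq : 0 < q)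
    (hfin : ∀ t : ℝ, 0 < t → decreasingRearrangement f t ≠ ⊤) (hdec : DecaysAtInfinity f) :
    lorentzNorm q p f ^ p = ENNReal.ofReal q *
      ∫⁻ s in Ioi (0 : ℝ), ENNReal.ofReal (s ^ (p - 1)) * distribution f s ^ (p / q) := by
  have hr : 0 < p / q := by positivity
  have hm : Measurable (distribution f) := (distribution_antitone f).measurable
  rw [lorentzNorm, ← ENNReal.rpow_mul, one_div_mul_cancel hp.ne', ENNReal.rpow_one]
  -- Tonelli on the region `t < μ_f(s)`: the layer cake in `s` contributes a factor `p`, and the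
  -- integral in `t` contributes `q / p`.
  let F : ℝ → ℝ → ℝ≥0∞ := fun t s => ENNReal.ofReal (t ^ (p / q - 1)) *
    (ENNReal.ofReal (s ^ (p - 1)) * {s | ENNReal.ofReal t < distribution f s}.indicator 1 s)
  have hF : Measurable (Function.uncurry F) := by
    have hset : MeasurableSet {z : ℝ × ℝ | ENNReal.ofReal z.1 < distribution f z.2} :=
      measurableSet_lt measurable_fst.ennreal_ofReal (hm.comp measurable_snd)
    exact (measurable_fst.pow_const _).ennreal_ofReal.mul
      ((measurable_snd.pow_const _).ennreal_ofReal.mul (measurable_one.indicator hset))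
  have h1 : ∀ t ∈ Ioi (0 : ℝ), (ENNReal.ofReal (t ^ (1 / q)) * decreasingRearrangement f t) ^ p /
      ENNReal.ofReal t = ENNReal.ofReal p * ∫⁻ s in Ioi (0 : ℝ), F t s := by
    intro t ht
    have ht : 0 < t := ht
    have e : ENNReal.ofReal (t ^ (1 / q)) ^ p / ENNReal.ofReal t =
        ENNReal.ofReal (t ^ (p / q - 1)) := by
      rw [ENNReal.ofReal_rpow_of_pos (by positivity), ← ENNReal.ofReal_div_of_pos ht,
        ← Real.rpow_mul ht.le, Real.rpow_sub_one ht.ne', one_div_mul_eq_div]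
    rw [ENNReal.mul_rpow_of_nonneg _ _ hp.le, mul_comm, mul_div_assoc, e,
      decreasingRearrangement_rpow hp (hfin t ht), lintegral_const_mul' _ _ ENNReal.ofReal_ne_top]
    ring
  rw [setLIntegral_congr_fun measurableSet_Ioi h1, lintegral_const_mul' _ _ ENNReal.ofReal_ne_top,
    lintegral_lintegral_swap hF.aemeasurable]
  have h2 : ∀ s ∈ Ioi (0 : ℝ), ENNReal.ofReal (p / q) * ∫⁻ t in Ioi (0 : ℝ), F t s =
      ENNReal.ofReal (s ^ (p - 1)) * distribution f s ^ (p / q) := by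
    intro s hs
    have hd : distribution f s ≠ ⊤ := (hdec s hs).ne
    have e : ∀ t ∈ Ioi (0 : ℝ), F t s = ENNReal.ofReal (s ^ (p - 1)) *
        (ENNReal.ofReal (t ^ (p / q - 1)) * (Iio (distribution f s).toReal).indicator 1 t) := by
      intro t ht
      have : {s | ENNReal.ofReal t < distribution f s}.indicator (1 : ℝ → ℝ≥0∞) s =
          (Iio (distribution f s).toReal).indicator 1 t := by
        have hiff : ENNReal.ofReal t < distribution f s ↔ t < (distribution f s).toReal :=
          ENNReal.ofReal_lt_iff_lt_toReal (le_of_lt ht) hd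
        simp only [indicator_apply, mem_ofPred_eq, mem_Iio, hiff, Pi.one_apply]
      simp only [F, this]
      ring
    rw [setLIntegral_congr_fun measurableSet_Ioi e, lintegral_const_mul' _ _ ENNReal.ofReal_ne_top,
      mul_left_comm, lintegral_rpow_sub_one_indicator hr ENNReal.toReal_nonneg,
      ← ENNReal.ofReal_rpow_of_nonneg ENNReal.toReal_nonneg hr.le, ENNReal.ofReal_toReal hd]
  rw [← setLIntegral_congr_fun measurableSet_Ioi h2,
    lintegral_const_mul' _ _ ENNReal.ofReal_ne_top, ← mul_assoc, ← ENNReal.ofReal_mul hq.le,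
    mul_div_cancel₀ _ hq.ne']

/-- Since the distribution function decreases, its value at `s` bounds it from below on `(0, s)`.
This is the embedding of the Lorentz space into the weak space. -/
theorem rpow_mul_distribution_le {f : EuclideanSpace ℝ (Fin N) → ℝ} {p r s : ℝ} (hp : 0 < p)
    (hr : 0 ≤ r) (hs : 0 < s) : ENNReal.ofReal (s ^ p) * distribution f s ^ r ≤ ENNReal.ofReal p *
      ∫⁻ s in Ioi (0 : ℝ), ENNReal.ofReal (s ^ (p - 1)) * distribution f s ^ r := by
  rw [← lintegral_rpow_sub_one_indicator hp hs.le, mul_assoc]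
  gcongr
  have hm : Measurable fun σ : ℝ => ENNReal.ofReal (σ ^ (p - 1)) * (Iio s).indicator 1 σ :=
    (measurable_id.pow_const _).ennreal_ofReal.mul (measurable_one.indicator measurableSet_Iio)
  rw [← lintegral_mul_const _ hm]
  refine lintegral_mono fun σ => ?_
  by_cases h : σ < s
  · rw [indicator_of_mem (by exact h), Pi.one_apply, mul_one]
    gcongr
    exact distribution_antitone f h.le
  · rw [indicator_of_notMem (by exact h)]; simp

end Rearrangement

/-! ### The Hardy integral is bounded by the Lorentz norm. -/

section HardyLittlewood

open Module Filter Topology HardyStability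

variable {E : Type*} [NormedAddCommGroup E] [InnerProductSpace ℝ E] [FiniteDimensional ℝ E]
  [MeasurableSpace E] [BorelSpace E] (μ : Measure E) [μ.IsAddHaarMeasure]

/-- The weighted measure `‖x‖ ^ (-p) dx` of a set is controlled by a power of its volume. -/
theorem exists_setLIntegral_norm_rpow_neg_le {p : ℝ} (hp : 0 < p) (hd : p < finrank ℝ E) :
    ∃ C : ℝ, 0 < C ∧ ∀ S : Set E, μ S ≠ ⊤ → ∫⁻ x in S, ENNReal.ofReal (‖x‖ ^ (-p)) ∂μ ≤
      ENNReal.ofReal C * μ S ^ (1 - p / finrank ℝ E) := by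
  set d : ℝ := (finrank ℝ E : ℝ) with hdd
  have hd0 : 0 < d := hp.trans hd
  set A := ∫ x, (Metric.ball (0 : E) 1).indicator (fun x => ‖x‖ ^ (-p)) x ∂μ
  have hA0 : 0 ≤ A := integral_nonneg fun x => indicator_nonneg (fun x _ => by positivity) x
  have hball : ∀ R : ℝ, 0 < R → ∫⁻ x in Metric.ball (0 : E) R, ENNReal.ofReal (‖x‖ ^ (-p)) ∂μ =
      ENNReal.ofReal (R ^ (d - p) * A) := by
    intro R hR
    have hi : IntegrableOn (fun x : E => ‖x‖ ^ (-p)) (Metric.ball 0 R) μ :=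
      ((locallyIntegrable_norm_rpow_neg μ hp hd).integrableOn_isCompact
        (isCompact_closedBall 0 R)).mono_set Metric.ball_subset_closedBall
    rw [← ofReal_integral_eq_lintegral_ofReal hi (.of_forall fun x => by positivity)]
    congr 1
    have h1 := Measure.integral_comp_inv_smul_of_nonneg μ
      ((Metric.ball (0 : E) 1).indicator fun x => ‖x‖ ^ (-p)) hR.le
    have h2 : ∀ x : E, (Metric.ball (0 : E) 1).indicator (fun x => ‖x‖ ^ (-p)) (R⁻¹ • x) =
        R ^ p * (Metric.ball (0 : E) R).indicator (fun x => ‖x‖ ^ (-p)) x := by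
      intro x
      have hiff : R⁻¹ • x ∈ Metric.ball (0 : E) 1 ↔ x ∈ Metric.ball (0 : E) R := by
        rw [mem_ball_zero_iff, mem_ball_zero_iff, norm_smul, norm_inv, Real.norm_of_nonneg hR.le,
          inv_mul_lt_iff₀ hR, mul_one]
      by_cases hx : x ∈ Metric.ball (0 : E) R
      · rw [indicator_of_mem (hiff.2 hx), indicator_of_mem hx, norm_smul, norm_inv,
          Real.norm_of_nonneg hR.le, Real.mul_rpow (by positivity) (norm_nonneg _),
          Real.inv_rpow hR.le, Real.rpow_neg hR.le, inv_inv]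
      · rw [indicator_of_notMem (mt hiff.1 hx), indicator_of_notMem hx, mul_zero]
    simp_rw [h2] at h1
    rw [integral_const_mul, integral_indicator measurableSet_ball, smul_eq_mul,
      ← Real.rpow_natCast, ← hdd] at h1
    rw [Real.rpow_sub hR, div_mul_eq_mul_div, ← h1]
    field_simp
  refine ⟨A + 1, by positivity, fun S hS => ?_⟩
  set V := (μ S).toReal
  have hV : μ S = ENNReal.ofReal V := (ENNReal.ofReal_toReal hS).symm
  have hr : 0 < 1 - p / d := by rw [sub_pos, div_lt_one hd0]; exact hd
  rcases (ENNReal.toReal_nonneg : 0 ≤ V).eq_or_lt with h0 | hV0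
  · have : μ S = 0 := by rw [hV, show V = 0 from h0.symm, ENNReal.ofReal_zero]
    rw [Measure.restrict_eq_zero.2 this, lintegral_zero_measure]
    exact zero_le
  -- This radius balances the mass inside the ball, of order `R ^ (d - p)`, with the bound `R ^ (-p)
  -- * V` outside.
  set R := V ^ (1 / d)
  have hR : 0 < R := by positivity
  have e1 : R ^ (d - p) = V ^ (1 - p / d) := by
    rw [← Real.rpow_mul hV0.le]; congr 1; field_simp
  have e2 : R ^ (-p) * V = V ^ (1 - p / d) := by
    rw [← Real.rpow_mul hV0.le, ← Real.rpow_add_one hV0.ne']; congr 1; ring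
  have hout : ∫⁻ x in S \ Metric.ball 0 R, ENNReal.ofReal (‖x‖ ^ (-p)) ∂μ ≤
      ENNReal.ofReal (R ^ (-p)) * μ S := by
    calc _ ≤ ∫⁻ _ in S \ Metric.ball 0 R, ENNReal.ofReal (R ^ (-p)) ∂μ := by
          refine setLIntegral_mono measurable_const fun x hx => ENNReal.ofReal_le_ofReal ?_
          have : R ≤ ‖x‖ := by simpa using hx.2
          exact Real.rpow_le_rpow_of_nonpos hR this (by linarith)
      _ = ENNReal.ofReal (R ^ (-p)) * μ (S \ Metric.ball 0 R) := setLIntegral_const _ _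
      _ ≤ _ := by gcongr; exact sdiff_subset
  calc ∫⁻ x in S, ENNReal.ofReal (‖x‖ ^ (-p)) ∂μ
      ≤ ∫⁻ x in Metric.ball 0 R ∪ S \ Metric.ball 0 R, ENNReal.ofReal (‖x‖ ^ (-p)) ∂μ :=
        lintegral_mono_set (by rw [union_sdiff_self]; exact subset_union_right)
    _ ≤ _ := lintegral_union_le _ _ _
    _ ≤ ENNReal.ofReal (R ^ (d - p) * A) + ENNReal.ofReal (R ^ (-p)) * μ S := by
        rw [hball R hR]; gcongr
    _ = ENNReal.ofReal (A + 1) * μ S ^ (1 - p / d) := by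
        rw [hV, ENNReal.ofReal_rpow_of_pos hV0, ← ENNReal.ofReal_mul (by positivity),
          ← ENNReal.ofReal_mul (by positivity), ← ENNReal.ofReal_add (by positivity)
          (by positivity), e1, e2]
        congr 1; ring

/-- Hardy-Littlewood type bound of the Hardy potential by a Lorentz norm. -/
theorem exists_lintegral_hardy_le {p : ℝ} (hp : 0 < p) (hd : p < finrank ℝ E) :
    ∃ C : ℝ, 0 < C ∧ ∀ u : E → ℝ, AEMeasurable u μ →
      (∀ s : ℝ, 0 < s → μ {x | s < |u x|} < ⊤) →
      ∫⁻ x, ENNReal.ofReal (|u x| ^ p / ‖x‖ ^ p) ∂μ ≤ ENNReal.ofReal C *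
        ∫⁻ s in Ioi (0 : ℝ), ENNReal.ofReal (s ^ (p - 1)) *
          μ {x | s < |u x|} ^ (1 - p / finrank ℝ E) := by
  obtain ⟨C, hC, h⟩ := exists_setLIntegral_norm_rpow_neg_le μ hp hd
  refine ⟨p * C, by positivity, fun u hu hfin => ?_⟩
  have hwm : Measurable fun x : E => ENNReal.ofReal (‖x‖ ^ (-p)) :=
    (measurable_norm.pow_const _).ennreal_ofReal
  -- Layer cake with respect to `‖x‖ ^ (-p) dx`, whose value on each superlevel set is bounded by a
  -- power of the volume.
  set ν := μ.withDensity fun x => ENNReal.ofReal (‖x‖ ^ (-p)) with hν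
  have hac : ν ≪ μ := withDensity_absolutelyContinuous _ _
  have hlc := lintegral_rpow_eq_lintegral_meas_lt_mul ν (f := fun x => |u x|)
    (.of_forall fun x => abs_nonneg _) (hu.abs.mono_ac hac) hp
  have hH : ∫⁻ x, ENNReal.ofReal (|u x| ^ p) ∂ν =
      ∫⁻ x, ENNReal.ofReal (|u x| ^ p / ‖x‖ ^ p) ∂μ := by
    rw [hν, lintegral_withDensity_eq_lintegral_mul₀ hwm.aemeasurable
      (hu.abs.pow_const p).ennreal_ofReal]
    refine lintegral_congr fun x => ?_
    rw [Pi.mul_apply, ← ENNReal.ofReal_mul (by positivity), Real.rpow_neg (norm_nonneg _)]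
    congr 1; ring
  rw [← hH, hlc, ENNReal.ofReal_mul hp.le, mul_assoc]
  gcongr ENNReal.ofReal p * ?_
  rw [← lintegral_const_mul' _ _ ENNReal.ofReal_ne_top]
  refine setLIntegral_mono' measurableSet_Ioi fun s hs => ?_
  have hms : NullMeasurableSet {x | s < |u x|} μ := hu.abs.nullMeasurable (measurableSet_Ioi (a := s))
  rw [hν, withDensity_apply₀ _ hms, mul_comm, mul_left_comm]
  exact mul_le_mul_right (h _ (hfin s hs).ne) _

end HardyLittlewood

/-! ### Optimization in the parameter and conclusion. -/

section Main

open HardyStability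

/-- Recovers the geometric mean from its linearized form. The choice `t = X / (2 * δ)` degenerates
at `δ = 0`, where a large `t` forces a contradiction. -/
theorem sq_le_of_forall_le_add_div {X δ B : ℝ} (hX : 0 ≤ X) (hδ : 0 ≤ δ) (hB : 0 ≤ B)
    (h : ∀ t : ℝ, 0 < t → X ≤ t * δ + B / t) : X ^ 2 ≤ 4 * B * δ := by
  rcases hX.eq_or_lt with h0 | hX0
  · rw [show X ^ 2 = 0 by rw [← h0]; norm_num]
    positivity
  rcases hδ.eq_or_lt with h0 | hδ0
  · have h1 := h ((2 * B + 1) / X) (by positivity)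
    rw [← h0, mul_zero, zero_add, div_div_eq_mul_div, le_div_iff₀ (by positivity)] at h1
    nlinarith
  · have h1 := h (X / (2 * δ)) (by positivity)
    have e1 : X / (2 * δ) * δ = X / 2 := by field_simp
    have e2 : B / (X / (2 * δ)) = 2 * B * δ / X := by field_simp
    rw [e1, e2] at h1
    have h2 : X / 2 ≤ 2 * B * δ / X := by linarith
    rw [le_div_iff₀ hX0] at h2
    nlinarith

theorem sobolevExponent_pos {N : ℕ} {p : ℝ} (hp : 1 < p) (hpN : p < N) :
    0 < HardyStability.sobolevExponent N p := by
  unfold HardyStability.sobolevExponent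
  have : (0 : ℝ) < N := by linarith
  exact div_pos (by positivity) (by linarith)

theorem inv_sobolevExponent {N : ℕ} {p : ℝ} (hp : 1 < p) (hpN : p < N) :
    (HardyStability.sobolevExponent N p)⁻¹ = p⁻¹ - (N : ℝ)⁻¹ := by
  unfold HardyStability.sobolevExponent
  have : (0 : ℝ) < N := by linarith
  have : (0 : ℝ) < N - p := by linarith
  field_simp

/-- The Hardy deficit controls the ratio of the weak Lebesgue and Lorentz norms. -/
theorem deficit_ge_of_energy_bounds {p κ W L H g δ C a b : ℝ} (hp : 1 < p) (hκ : 2 * p ≤ κ)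
    (hW : 0 ≤ W) (hWL : W ≤ L) (hL : 0 < L) (hH : 0 ≤ H) (hC : 0 < C) (ha : 0 < a) (hb : 0 ≤ b)
    (hδ : δ = g - b * H) (hδ0 : 0 ≤ δ) (hLH : a * H ≤ L ^ p)
    (hw : ∀ t : ℝ, 0 < t → W ^ p ≤ t * δ + C * g / t) :
    min 1 (a ^ 2 / (4 * C * (1 + b))) * (W / L) ^ κ * H ≤ δ := by
  have hg : 0 ≤ g := by nlinarith
  have hρ0 : 0 ≤ W / L := by positivity
  have hρ1 : W / L ≤ 1 := div_le_one_of_le₀ hWL hL.le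
  -- If `δ ≥ H` the claim is trivial, as the constant and the ratio are at most 1. Otherwise the
  -- energy is below `(1 + b) * H`, so the geometric-mean bound involves only `H` and `δ`.
  rcases le_or_gt H δ with h | h
  · have : min 1 (a ^ 2 / (4 * C * (1 + b))) * (W / L) ^ κ ≤ 1 :=
      mul_le_one₀ (min_le_left _ _) (by positivity)
        (Real.rpow_le_one hρ0 hρ1 (by linarith))
    exact (mul_le_of_le_one_left hH this).trans h
  · have hH0 : 0 < H := lt_of_le_of_lt hδ0 h
    have hsq := sq_le_of_forall_le_add_div (by positivity) hδ0 (by positivity) hw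
    have hgH : g ≤ (1 + b) * H := by linarith
    have h1 : (W ^ p) ^ 2 ≤ 4 * C * (1 + b) * H * δ := by
      calc (W ^ p) ^ 2 ≤ 4 * (C * g) * δ := hsq
        _ ≤ 4 * (C * ((1 + b) * H)) * δ := by gcongr
        _ = _ := by ring
    have h2 : (W / L) ^ κ ≤ (W / L) ^ (2 * p) := by
      rcases hρ0.eq_or_lt with h0 | h0
      · rw [← h0, Real.zero_rpow (by linarith), Real.zero_rpow (by linarith)]
      · exact Real.rpow_le_rpow_of_exponent_ge h0 hρ1 hκ
    have h3 : (W / L) ^ (2 * p) = (W ^ p) ^ 2 / (L ^ p) ^ 2 := by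
      rw [← div_pow, ← Real.div_rpow hW hL.le, mul_comm, Real.rpow_mul hρ0]
      norm_num
    have h4 : (W / L) ^ (2 * p) ≤ 4 * C * (1 + b) * H * δ / (a * H) ^ 2 := by
      rw [h3]; gcongr
    calc min 1 (a ^ 2 / (4 * C * (1 + b))) * (W / L) ^ κ * H
        ≤ a ^ 2 / (4 * C * (1 + b)) * (4 * C * (1 + b) * H * δ / (a * H) ^ 2) * H := by
          gcongr
          · exact min_le_right _ _
          · exact h2.trans h4
      _ = δ := by field_simp

theorem theorem3 (N : ℕ) (hN : 2 ≤ N) (p : ℝ) (hp : 1 < p) (hpN : p < N) :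
    ∃ C : ℝ, 0 < C ∧
      ∀ (u : EuclideanSpace ℝ (Fin N) → ℝ)
        (G : EuclideanSpace ℝ (Fin N) → EuclideanSpace ℝ (Fin N)),
        HardyStability.IsWeakGradient u G →
        HardyStability.DecaysAtInfinity u →
        MemLp G (ENNReal.ofReal p) volume →
          Integrable (fun x => |u x| ^ p / ‖x‖ ^ p) volume ∧
          HardyStability.lorentzNorm (HardyStability.sobolevExponent N p) p u ≠ ⊤ ∧
          HardyStability.hardyDistance p u ≠ ⊤ ∧
          HardyStability.hardyDeficit p u G ≥
            C * (HardyStability.hardyDistance p u).toReal ^ (max 4 (2 * p)) *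
              HardyStability.hardyIntegral p u := by
  have hp0 : 0 < p := by linarith
  set q := sobolevExponent N p with hqdef
  have hq : 0 < q := sobolevExponent_pos hp hpN
  have hqinv : q⁻¹ = p⁻¹ - (N : ℝ)⁻¹ := inv_sobolevExponent hp hpN
  have hN0 : (0 : ℝ) < N := by linarith
  have hpq : p ≤ q := by
    rw [← inv_le_inv₀ hq hp0, hqinv]
    linarith [inv_pos.2 hN0]
  have hpq' : 1 - p / N = p / q := by
    rw [div_eq_mul_inv p q, hqinv]; field_simp
  set c : ℝ := (N - p) / p with hc
  have hc0 : 0 < c := div_pos (by linarith) hp0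
  have hfr : (Module.finrank ℝ (EuclideanSpace ℝ (Fin N)) : ℝ) = N := by simp
  obtain ⟨C, hC, hCb⟩ := exists_energyBounds_of_contDiff
    (volume : Measure (EuclideanSpace ℝ (Fin N))) hp (by rw [hfr]; exact hpN) hq
    (by rw [hfr]; exact hqinv) (c := c) (by rw [hfr])
  obtain ⟨A, hA, hAb⟩ := exists_lintegral_hardy_le
    (volume : Measure (EuclideanSpace ℝ (Fin N))) hp0 (by rw [hfr]; exact hpN)
  rw [hfr, hpq'] at hAb
  refine ⟨min 1 ((q / A) ^ 2 / (4 * C * (1 + c ^ p))), by positivity,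
    fun u G hG hdec hmem => ?_⟩
  obtain ⟨hhardy, hlor, hweak⟩ := energyBounds_of_isWeakGradient hp hq hCb hG hdec
  have hum : AEMeasurable u volume := hG.locallyIntegrable.aestronglyMeasurable.aemeasurable
  have hgfin : ∫⁻ x, ‖G x‖ₑ ^ p ≠ ⊤ := by
    have := lintegral_rpow_enorm_lt_top_of_eLpNorm_lt_top (by simpa using hp0)
      ENNReal.ofReal_ne_top hmem.eLpNorm_lt_top
    rw [ENNReal.toReal_ofReal hp0.le] at this
    exact this.ne
  set ge := ∫⁻ x, ‖G x‖ₑ ^ p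
  set He := ∫⁻ x, ENNReal.ofReal (|u x| ^ p / ‖x‖ ^ p) with hHe
  set D := ∫⁻ s in Ioi (0 : ℝ), ENNReal.ofReal (s ^ (p - 1)) * distribution u s ^ (p / q)
    with hD
  have hlor' : D ≤ ENNReal.ofReal C * ge := hlor
  have hDfin : D ≠ ⊤ := ne_top_of_le_ne_top (ENNReal.mul_ne_top ENNReal.ofReal_ne_top hgfin) hlor'
  have hHD : He ≤ ENNReal.ofReal A * D := hAb u hum hdec
  have hHfin : He ≠ ⊤ := ne_top_of_le_ne_top (ENNReal.mul_ne_top ENNReal.ofReal_ne_top hDfin) hHD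
  -- the weak norm
  have hroot : ∀ K : ℝ≥0∞, (∀ s : ℝ, 0 < s →
      ENNReal.ofReal (s ^ p) * distribution u s ^ (p / q) ≤ K) → weakNorm q u ≤ K ^ (1 / p) := by
    intro K hK
    refine weakNorm_le hq fun s hs => ?_
    have h1 := ENNReal.rpow_le_rpow (hK s hs) (by positivity : 0 ≤ 1 / p)
    rw [ENNReal.mul_rpow_of_nonneg _ _ (by positivity), ← ENNReal.ofReal_rpow_of_pos hs,
      ← ENNReal.rpow_mul, ← ENNReal.rpow_mul, mul_one_div_cancel hp0.ne', ENNReal.rpow_one] at h1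
    convert h1 using 3
    field_simp
  have hrootp : ∀ K : ℝ≥0∞, (K ^ (1 / p)) ^ p = K := fun K => by
    rw [← ENNReal.rpow_mul, one_div_mul_cancel hp0.ne', ENNReal.rpow_one]
  have hWD : weakNorm q u ≤ (ENNReal.ofReal p * D) ^ (1 / p) :=
    hroot _ fun s hs => rpow_mul_distribution_le hp0 (by positivity) hs
  have hWfin : weakNorm q u ≠ ⊤ := ne_top_of_le_ne_top (ENNReal.rpow_ne_top_of_nonneg
    (by positivity) (ENNReal.mul_ne_top ENNReal.ofReal_ne_top hDfin)) hWD
  have hrearr : ∀ t : ℝ, 0 < t → decreasingRearrangement u t ≠ ⊤ := by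
    intro t ht htop
    refine hWfin (top_le_iff.1 ?_)
    refine le_trans (le_of_eq ?_) (le_iSup₂ (f := fun (t : ℝ) (_ : 0 < t) =>
      ENNReal.ofReal (t ^ (1 / q)) * decreasingRearrangement u t) t ht)
    rw [htop, ENNReal.mul_top]
    simp [Real.rpow_pos_of_pos ht]
  have hLp : lorentzNorm q p u ^ p = ENNReal.ofReal q * D := lorentzNorm_rpow hp0 hq hrearr hdec
  have hLfin : lorentzNorm q p u ≠ ⊤ := by
    intro h
    rw [h, ENNReal.top_rpow_of_pos hp0] at hLp
    exact ENNReal.mul_ne_top ENNReal.ofReal_ne_top hDfin hLp.symm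
  -- The constant is 1 because `p ≤ q`: the two norms to the power `p` compare with `p * D` and `q *
  -- D`.
  have hWL : weakNorm q u ≤ lorentzNorm q p u := by
    rw [← ENNReal.rpow_le_rpow_iff hp0, hLp]
    calc _ ≤ ((ENNReal.ofReal p * D) ^ (1 / p)) ^ p := ENNReal.rpow_le_rpow hWD hp0.le
      _ = ENNReal.ofReal p * D := hrootp _
      _ ≤ _ := by gcongr
  have hdist : hardyDistance p u ≤ weakNorm q u / lorentzNorm q p u := by
    -- Only the zero member of the family is used.
    refine (iInf_le _ (0 : ℝ)).trans (le_of_eq ?_)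
    simp [virtualExtremal, hqdef]
  have hdistfin : hardyDistance p u ≠ ⊤ := by
    refine ne_top_of_le_ne_top ENNReal.one_ne_top (hdist.trans ?_)
    exact ENNReal.div_le_of_le_mul (by rwa [one_mul])
  -- real versions
  have hHm : AEStronglyMeasurable (fun x => |u x| ^ p / ‖x‖ ^ p) volume :=
    ((hum.abs.pow_const p).div (measurable_norm.pow_const p).aemeasurable).aestronglyMeasurable
  have hHnn : ∀ x, 0 ≤ |u x| ^ p / ‖x‖ ^ p := fun x => by positivity
  have hHint : hardyIntegral p u = He.toReal :=
    integral_eq_lintegral_of_nonneg_ae (.of_forall hHnn) hHm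
  have hgint : ∫ x, ‖G x‖ ^ p = ge.toReal := by
    rw [integral_eq_lintegral_of_nonneg_ae (.of_forall fun x => by positivity)
      ((hG.locallyIntegrable_grad.aestronglyMeasurable.norm.aemeasurable.pow_const
        p).aestronglyMeasurable)]
    congr 1
    refine lintegral_congr fun x => ?_
    rw [← ofReal_norm, ENNReal.ofReal_rpow_of_nonneg (norm_nonneg _) hp0.le]
  have hdef : hardyDeficit p u G = ge.toReal - c ^ p * He.toReal := by
    rw [hardyDeficit, hHint, hgint]
  have hcp : 0 < c ^ p := by positivity
  have hδ0 : 0 ≤ ge.toReal - c ^ p * He.toReal := by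
    have := ENNReal.toReal_mono hgfin hhardy
    rw [ENNReal.toReal_mul, ENNReal.toReal_ofReal hcp.le] at this
    linarith
  refine ⟨⟨hHm, ?_⟩, hLfin, hdistfin, ?_⟩
  · rw [hasFiniteIntegral_iff_ofReal (.of_forall hHnn)]
    exact hHfin.lt_top
  rw [hdef, hHint, ge_iff_le]
  -- A vanishing Lorentz norm forces the Hardy integral to vanish, so the right side is zero.
  rcases eq_or_ne (lorentzNorm q p u) 0 with hL0 | hL0
  · have : D = 0 := by
      rw [hL0, ENNReal.zero_rpow_of_pos hp0] at hLp
      simpa [not_le.2 hq] using hLp.symm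
    have : He = 0 := by
      rw [this, mul_zero] at hHD
      exact le_antisymm hHD zero_le
    simp [this]
  have hLpos : 0 < (lorentzNorm q p u).toReal := ENNReal.toReal_pos hL0 hLfin
  have hfinal := deficit_ge_of_energy_bounds (κ := max 4 (2 * p)) (W := (weakNorm q u).toReal)
    (L := (lorentzNorm q p u).toReal) (H := He.toReal) (g := ge.toReal) (C := C) (a := q / A)
    (b := c ^ p) hp (le_max_right _ _) ENNReal.toReal_nonneg (ENNReal.toReal_mono hLfin hWL) hLpos
    ENNReal.toReal_nonneg hC (by positivity) hcp.le rfl hδ0 ?_ ?_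
  · refine le_trans ?_ hfinal
    have h1 : (hardyDistance p u).toReal ≤
        (weakNorm q u).toReal / (lorentzNorm q p u).toReal := by
      rw [← ENNReal.toReal_div]
      exact ENNReal.toReal_mono (ENNReal.div_ne_top hWfin hL0) hdist
    gcongr
  · have h1 := ENNReal.toReal_mono (ENNReal.mul_ne_top ENNReal.ofReal_ne_top hDfin) hHD
    rw [ENNReal.toReal_mul, ENNReal.toReal_ofReal hA.le] at h1
    have h2 := congrArg ENNReal.toReal hLp
    rw [ENNReal.toReal_mul, ENNReal.toReal_ofReal hq.le, ← ENNReal.toReal_rpow] at h2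
    rw [h2, div_mul_eq_mul_div, div_le_iff₀ hA]
    nlinarith
  · intro t ht
    set K : ℝ := t * (ge.toReal - c ^ p * He.toReal) + C * ge.toReal / t with hK
    have hK0 : 0 ≤ K := by positivity
    have hWK : weakNorm q u ≤ ENNReal.ofReal K ^ (1 / p) := by
      refine hroot _ fun s hs => ?_
      have h1 := hweak s hs t ht
      have e1 : ENNReal.ofReal (t * c ^ p) * He = ENNReal.ofReal (t * c ^ p * He.toReal) := by
        rw [ENNReal.ofReal_mul (by positivity : 0 ≤ t * c ^ p), ENNReal.ofReal_toReal hHfin]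
      have e2 : ENNReal.ofReal (t + C / t) * ge = ENNReal.ofReal ((t + C / t) * ge.toReal) := by
        rw [ENNReal.ofReal_mul (by positivity), ENNReal.ofReal_toReal hgfin]
      rw [e1, e2] at h1
      have h2 := ENNReal.le_sub_of_add_le_right ENNReal.ofReal_ne_top h1
      rw [← ENNReal.ofReal_sub _ (by positivity)] at h2
      refine h2.trans (ENNReal.ofReal_le_ofReal (le_of_eq ?_))
      rw [hK]; ring
    have h3 := ENNReal.rpow_le_rpow hWK hp0.le
    rw [hrootp] at h3
    have h4 := ENNReal.toReal_mono ENNReal.ofReal_ne_top h3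
    rwa [← ENNReal.toReal_rpow, ENNReal.toReal_ofReal hK0] at h4

end Main

end
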